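/- Let $K$ be an algebraically closed field, $n\ge 0$, $R=K[x_0,\dots,x_n]$ with its standard grading, and $\mathbb P^n=\operatorname{Proj}(R)$. Let $Z\subseteq\mathbb P^n$ be a closed subscheme with homogeneous (saturated) ideal $I_Z\subseteq R$, and let $p\in\mathbb P^n$ be a closed point with $p\notin Z$ and homogeneous ideal $\mathfrak p\subseteq R$. Let $S=K[\mathfrak p_1]\subseteq R$ be the subalgebra generated by the linear forms in $\mathfrak p$; for every linear form $y\in R_1\setminus\mathfrak p_1$ we have $R=S[y]$, a polynomial ring in $y$ over $S$. For $k\ge 0$ let $$\mathcal K^p_k(I_Z)=\{f\in S \mid \forall y\in R_1\setminus\mathfrak p_1\ \exists g\in R:\ \deg_y(g)<k \text{ and } y^kf+g\in I_Z\}$$ be the $k$-th partial elimination ideal (a graded ideal of $S$), and let $\mathcal K^p_{-1}(I_Z)=0$. For a line $\mathbb L\subseteq\mathbb P^n$ through $p$, with ideal $I_{\mathbb L}$, let $l(Z\cap\mathbb L)$ be the length of the scheme-theoretic intersection, i.e. the value of $\dim_K\big(R/(I_Z+I_{\mathbb L})\big)_d$ for all large $d$. For $k\ge 0$, the $k$-secant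 cone $\operatorname{Sec}^k_p(Z)$ is the set of closed points $$\{p\}\cup\bigcup\{\mathbb L\mid \mathbb L\text{ a line with } p\in\mathbb L,\ l(Z\cap\mathbb L)\ge k\},$$ with its structure of reduced closed subscheme of $\mathbb P^n$, and the $k$-secant locus is the scheme-theoretic intersection $\Sigma^k_p(Z)=Z\cap\operatorname{Sec}^k_p(Z)$. Then, for every $k\ge 0$, the set above is indeed closed in the space of closed points of $\mathbb P^n$, and the following equalities of closed subschemes of $\mathbb P^n$ hold. 1. If $\mathcal K^p_{k-1}(I_Z)\ne S$, then $\operatorname{Sec}^k_p(Z)=\operatorname{Proj}\left(R/\sqrt{\mathcal K^p_{k-1}(I_Z)R}\right)$. If $\mathcal K^p_{k-1}(I_Z)=S$ (so that this $\operatorname{Proj}$ is empty), then $\operatorname{Sec}^k_p(Z)$ is the reduced point $\{p\}$. 2. In all cases, $\Sigma^k_p(Z)=\operatorname{Proj}\left(R/\left(I_Z+\sqrt{\mathcal K^p_{k-1}(I_Z)R}\right)\right)$. -/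

import Mathlib

open AlgebraicGeometry MvPolynomial

universe u

attribute [local instance] MvPolynomial.gradedAlgebra

namespace SecantCone

/-! ### Residue class rings of graded rings by homogeneous ideals -/

section Quotient

variable {K A : Type u} [Field K] [CommRing A] [Algebra K A]
  (𝒜 : ℕ → Submodule K A) [GradedAlgebra 𝒜]

/-- The grading of `A ⧸ J`: its `d`-th component is the image of the `d`-th component of `A`. -/
def quotGrading (J : HomogeneousIdeal 𝒜) (d : ℕ) : Submodule K (A ⧸ J.toIdeal) :=
  (𝒜 d).map (Ideal.Quotient.mkₐ K J.toIdeal).toLinearMap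

theorem mk_mem_quotGrading (J : HomogeneousIdeal 𝒜) {d : ℕ} {a : A} (ha : a ∈ 𝒜 d) :
    Ideal.Quotient.mk J.toIdeal a ∈ quotGrading 𝒜 J d :=
  ⟨a, ha, rfl⟩

instance quotGrading_gradedMonoid (J : HomogeneousIdeal 𝒜) :
    SetLike.GradedMonoid (quotGrading 𝒜 J) where
  one_mem := ⟨1, SetLike.GradedOne.one_mem, map_one (Ideal.Quotient.mk J.toIdeal)⟩
  mul_mem := by
    rintro i j _ _ ⟨a, ha, rfl⟩ ⟨b, hb, rfl⟩
    exact ⟨a * b, SetLike.GradedMul.mul_mem ha hb, map_mul (Ideal.Quotient.mk J.toIdeal) a b⟩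

theorem quotGrading_isInternal (J : HomogeneousIdeal 𝒜) :
    DirectSum.IsInternal (quotGrading 𝒜 J) := by
  classical
  constructor
  · rw [injective_iff_map_eq_zero]
    intro x hx
    have hlift : ∀ i, ∃ a : 𝒜 i, Ideal.Quotient.mk J.toIdeal (a : A) = (x i : A ⧸ J.toIdeal) := by
      intro i
      obtain ⟨a, ha, h⟩ := (x i).2
      exact ⟨⟨a, ha⟩, h⟩
    choose a ha using hlift
    have hsum : (∑ i ∈ x.support, (a i : A)) ∈ J.toIdeal := by
      rw [← Ideal.Quotient.eq_zero_iff_mem, map_sum, ← hx, DirectSum.coeAddMonoidHom_eq_dfinsuppSum]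
      exact Finset.sum_congr rfl fun i _ => ha i
    ext i
    by_cases hi : i ∈ x.support
    · have h1 := J.isHomogeneous i hsum
      rw [DirectSum.decompose_sum, DFinsupp.finsetSum_apply, AddSubmonoidClass.coe_finsetSum,
        Finset.sum_eq_single i] at h1
      · rw [DirectSum.decompose_of_mem_same 𝒜 (a i).2] at h1
        rw [← ha i, Ideal.Quotient.eq_zero_iff_mem.mpr h1]
        rfl
      · intro j _ hji
        exact DirectSum.decompose_of_mem_ne 𝒜 (a j).2 hji
      · exact fun h => absurd hi h
    · rw [DFinsupp.notMem_support_iff.mp hi]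
      rfl
  · intro q
    obtain ⟨a, rfl⟩ := Ideal.Quotient.mk_surjective q
    refine ⟨∑ i ∈ (DirectSum.decompose 𝒜 a).support,
      DirectSum.of (fun i => quotGrading 𝒜 J i) i
        ⟨_, mk_mem_quotGrading 𝒜 J (DirectSum.decompose 𝒜 a i).2⟩, ?_⟩
    rw [map_sum]
    simp only [DirectSum.coeAddMonoidHom_of]
    rw [← map_sum, DirectSum.sum_support_decompose]

noncomputable instance quotGrading_decomposition (J : HomogeneousIdeal 𝒜) :
    DirectSum.Decomposition (quotGrading 𝒜 J) :=
  (quotGrading_isInternal 𝒜 J).chooseDecomposition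

noncomputable instance quotGrading_gradedAlgebra (J : HomogeneousIdeal 𝒜) :
    GradedAlgebra (quotGrading 𝒜 J) where

/-- The residue class map `A → A ⧸ J` as a homomorphism of graded rings. -/
def quotMap (J : HomogeneousIdeal 𝒜) : GradedRingHom 𝒜 (quotGrading 𝒜 J) where
  toRingHom := Ideal.Quotient.mk J.toIdeal
  map_mem ha := mk_mem_quotGrading 𝒜 J ha

theorem irrelevant_le_map_quotMap (J : HomogeneousIdeal 𝒜) :
    HomogeneousIdeal.irrelevant (quotGrading 𝒜 J) ≤
      (HomogeneousIdeal.irrelevant 𝒜).map (quotMap 𝒜 J) := by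
  rw [HomogeneousIdeal.irrelevant_le]
  rintro i hi _ ⟨a, ha, rfl⟩
  exact Ideal.mem_map_of_mem (quotMap 𝒜 J) (HomogeneousIdeal.mem_irrelevant_of_mem 𝒜 hi ha)

/-- The closed subscheme `Proj (A ⧸ J)` of `Proj A`, where closed subschemes are given by their
ideal sheaves: the kernel of the closed immersion `Proj (A ⧸ J) ⟶ Proj A` induced by `A → A ⧸ J`.
For two closed subschemes, `I ≤ I'` means that the one of `I'` is contained in the one of `I`. -/
noncomputable def projQuotient (J : HomogeneousIdeal 𝒜) : (Proj 𝒜).IdealSheafData :=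
  (Proj.map (quotMap 𝒜 J) (irrelevant_le_map_quotMap 𝒜 J)).ker

/-- The homogeneous (saturated) ideal of a closed subscheme `Z` of `Proj A`: the largest
homogeneous ideal `J` such that `Z ⊆ Proj (A ⧸ J)`. -/
noncomputable def idealOf (Z : (Proj 𝒜).IdealSheafData) : HomogeneousIdeal 𝒜 :=
  sSup {J | projQuotient 𝒜 J ≤ Z}

end Quotient

/-! ### Projective space, lines, secant cones and secant loci -/

section ProjectiveSpace

variable (n : ℕ) (K : Type u) [Field K]

/-- The standard grading of the polynomial ring `R = K[x₀, …, xₙ]`. -/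
abbrev grading : ℕ → Submodule K (MvPolynomial (Fin (n + 1)) K) :=
  homogeneousSubmodule (Fin (n + 1)) K

/-- Projective `n`-space `ℙⁿ = Proj K[x₀, …, xₙ]`. -/
noncomputable abbrev ProjSpace : Scheme.{u} := Proj (grading n K)

/-- A line in `ℙⁿ`, given by the `(n - 1)`-dimensional space of linear forms vanishing on it. -/
structure Line where
  forms : Submodule K (MvPolynomial (Fin (n + 1)) K)
  forms_le : forms ≤ grading n K 1
  finrank_forms : Module.finrank K forms + 1 = n

variable {n K}

/-- The homogeneous ideal of a line. -/
noncomputable def Line.ideal (L : Line n K) : HomogeneousIdeal (grading n K) :=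
  ⟨Ideal.span (L.forms : Set (MvPolynomial (Fin (n + 1)) K)),
    Ideal.homogeneous_span _ _ fun _ hf => ⟨1, L.forms_le hf⟩⟩

/-- The set of points of `ℙⁿ` that lie on the line `L`. -/
def Line.carrier (L : Line n K) : Set (ProjSpace n K) :=
  {x | L.ideal ≤ x.asHomogeneousIdeal}

/-- The length `l(X ∩ Y)` of the intersection of the closed subschemes `X`, `Y` of `ℙⁿ` with
homogeneous ideals `I`, `J`. If `dim (X ∩ Y) ≤ 0`, then `dim_K (R/(I+J))_d` is constant for large
`d` (the Hilbert polynomial is constant), and this constant is the length; it is the Hilbert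
multiplicity of `R/(I+J)` if `X ∩ Y` is not empty, and `0` if it is.
(If `dim (X ∩ Y) > 0`, the value is `⊤`.) -/
noncomputable def intersectionLength (I J : HomogeneousIdeal (grading n K)) : ℕ∞ :=
  Filter.liminf
    (fun d : ℕ => (Module.finrank K (quotGrading (grading n K) (I ⊔ J) d) : ℕ∞)) Filter.atTop

/-- `L` is a `k`-secant line to `Z`: `l(Z ∩ L) ≥ k`. -/
def IsSecantLine (k : ℕ) (Z : (ProjSpace n K).IdealSheafData) (L : Line n K) : Prop :=
  (k : ℕ∞) ≤ intersectionLength (idealOf (grading n K) Z) L.ideal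

/-- The set of closed points of the `k`-secant cone of `Z` with vertex `p`: the point `p` and all
closed points on `k`-secant lines to `Z` through `p`. -/
def secantConePoints (k : ℕ) (Z : (ProjSpace n K).IdealSheafData) (p : ProjSpace n K) :
    Set (ProjSpace n K) :=
  {x | IsClosed {x} ∧
    (x = p ∨ ∃ L : Line n K, IsSecantLine k Z L ∧ p ∈ L.carrier ∧ x ∈ L.carrier)}

/-- The `k`-secant cone `Sec^k_p(Z)`: the reduced closed subscheme of `ℙⁿ` on the closed subset
whose set of closed points is `secantConePoints k Z p`. -/
noncomputable def secantCone (k : ℕ) (Z : (ProjSpace n K).IdealSheafData) (p : ProjSpace n K) :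
    (ProjSpace n K).IdealSheafData :=
  Scheme.IdealSheafData.vanishingIdeal (TopologicalSpace.Closeds.closure (secantConePoints k Z p))

/-- The `k`-secant locus `Σ^k_p(Z)`: the scheme-theoretic intersection of `Z` and `Sec^k_p(Z)`,
whose ideal sheaf is the sum of the two ideal sheaves. -/
noncomputable def secantLocus (k : ℕ) (Z : (ProjSpace n K).IdealSheafData) (p : ProjSpace n K) :
    (ProjSpace n K).IdealSheafData :=
  Z ⊔ secantCone k Z p

/-! ### Partial elimination ideals -/

/-- The subalgebra `S = K[𝔭₁]` of `R` generated by the linear forms of `𝔭`. -/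
noncomputable def subalg (p : HomogeneousIdeal (grading n K)) :
    Subalgebra K (MvPolynomial (Fin (n + 1)) K) :=
  Algebra.adjoin K {f | f ∈ p ∧ f ∈ grading n K 1}

/-- The `S`-module of all `g ∈ R = S[y]` with `deg_y g < k`, that is, of all `S`-linear
combinations of `1, y, …, y^(k-1)`. -/
noncomputable def degLT (p : HomogeneousIdeal (grading n K)) (y : MvPolynomial (Fin (n + 1)) K) (k : ℕ) :
    Submodule (subalg p) (MvPolynomial (Fin (n + 1)) K) :=
  Submodule.span (subalg p) {m | ∃ i < k, m = y ^ i}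

/-- The `k`-th partial elimination ideal of `a` with respect to `𝔭`, for `k ≥ 0`: all `f ∈ S`
such that for every linear form `y ∉ 𝔭` there is a `g` with `deg_y g < k` and `y^k f + g ∈ a`. -/
noncomputable def partialElimNat (p a : HomogeneousIdeal (grading n K)) (k : ℕ) : Ideal (subalg p) where
  carrier := {f | ∀ y ∈ grading n K 1, y ∉ p → ∃ g ∈ degLT p y k, y ^ k * f + g ∈ a}
  add_mem' := by
    intro f f' hf hf' y hy hyp
    obtain ⟨g, hg, h⟩ := hf y hy hyp
    obtain ⟨g', hg', h'⟩ := hf' y hy hyp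
    refine ⟨g + g', add_mem hg hg', ?_⟩
    have := a.toIdeal.add_mem h h'
    rw [AddMemClass.coe_add, mul_add, add_add_add_comm]
    exact this
  zero_mem' := fun y _ _ => ⟨0, zero_mem _, by simp⟩
  smul_mem' := by
    intro s f hf y hy hyp
    obtain ⟨g, hg, h⟩ := hf y hy hyp
    refine ⟨s • g, Submodule.smul_mem _ s hg, ?_⟩
    have := a.toIdeal.mul_mem_left (s : MvPolynomial (Fin (n + 1)) K) h
    rw [smul_eq_mul, MulMemClass.coe_mul, Subalgebra.smul_def, smul_eq_mul, mul_left_comm,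
      ← mul_add]
    exact this

/-- The partial elimination ideals `𝒦_k` of `a` with respect to `𝔭`, with `𝒦_{-1} = 0`. -/
noncomputable def partialElim (p a : HomogeneousIdeal (grading n K)) : ℤ → Ideal (subalg p)
  | Int.ofNat k => partialElimNat p a k
  | Int.negSucc _ => ⊥

theorem proj_mem_subalg (p : HomogeneousIdeal (grading n K))
    {f : MvPolynomial (Fin (n + 1)) K} (hf : f ∈ subalg p) (d : ℕ) :
    (DirectSum.decompose (grading n K) f d : MvPolynomial (Fin (n + 1)) K) ∈ subalg p := by
  classical
  induction hf using Algebra.adjoin_induction generalizing d with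
  | mem x hx =>
    by_cases h : 1 = d
    · subst h
      rw [DirectSum.decompose_of_mem_same _ hx.2]
      exact Algebra.subset_adjoin hx
    · rw [DirectSum.decompose_of_mem_ne _ hx.2 h]
      exact zero_mem _
  | algebraMap r =>
    have hr : algebraMap K (MvPolynomial (Fin (n + 1)) K) r ∈ grading n K 0 :=
      SetLike.algebraMap_mem_graded (grading n K) r
    by_cases h : 0 = d
    · subst h
      rw [DirectSum.decompose_of_mem_same _ hr]
      exact Subalgebra.algebraMap_mem _ r
    · rw [DirectSum.decompose_of_mem_ne _ hr h]
      exact zero_mem _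
  | add x y _ _ hx hy =>
    rw [DirectSum.decompose_add, DirectSum.add_apply, AddMemClass.coe_add]
    exact add_mem (hx d) (hy d)
  | mul x y _ _ hx hy =>
    rw [DirectSum.decompose_mul, DirectSum.coe_mul_apply]
    exact sum_mem fun ij _ => mul_mem (hx _) (hy _)

theorem proj_mem_degLT (p : HomogeneousIdeal (grading n K)) {y : MvPolynomial (Fin (n + 1)) K}
    (hy : y ∈ grading n K 1) (k : ℕ) {g : MvPolynomial (Fin (n + 1)) K} (hg : g ∈ degLT p y k)
    (d : ℕ) :
    (DirectSum.decompose (grading n K) g d : MvPolynomial (Fin (n + 1)) K) ∈ degLT p y k := by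
  classical
  refine Submodule.closure_induction (p := fun g _ =>
    (DirectSum.decompose (grading n K) g d : MvPolynomial (Fin (n + 1)) K) ∈ degLT p y k)
    ?_ ?_ ?_ hg
  · simp
  · intro x z _ _ hx hz
    rw [DirectSum.decompose_add, DirectSum.add_apply, AddMemClass.coe_add]
    exact add_mem hx hz
  · rintro s _ ⟨i, hi, rfl⟩
    have hyi : y ^ i ∈ grading n K i := by
      simpa using SetLike.pow_mem_graded (A := grading n K) i hy
    rw [Subalgebra.smul_def, smul_eq_mul, DirectSum.coe_decompose_mul_of_right_mem _ _ hyi]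
    split_ifs
    · exact Submodule.smul_mem _
        (⟨_, proj_mem_subalg p s.2 (d - i)⟩ : subalg p) (Submodule.subset_span ⟨i, hi, rfl⟩)
    · exact zero_mem _

theorem proj_mem_partialElim (p a : HomogeneousIdeal (grading n K)) (k : ℤ) (f : subalg p)
    (hf : f ∈ partialElim p a k) (d : ℕ) :
    (⟨DirectSum.decompose (grading n K) (f : MvPolynomial (Fin (n + 1)) K) d,
      proj_mem_subalg p f.2 d⟩ : subalg p) ∈ partialElim p a k := by
  match k with
  | Int.ofNat k =>
    intro y hy hyp
    obtain ⟨g, hg, h⟩ := hf y hy hyp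
    refine ⟨_, proj_mem_degLT p hy k hg (k + d), ?_⟩
    have hyk : y ^ k ∈ grading n K k := by
      simpa using SetLike.pow_mem_graded (A := grading n K) k hy
    have := a.isHomogeneous (k + d) h
    rw [DirectSum.decompose_add, DirectSum.add_apply, AddMemClass.coe_add,
      DirectSum.coe_decompose_mul_add_of_left_mem _ hyk] at this
    exact this
  | Int.negSucc _ =>
    have hf0 : f = 0 := hf
    subst hf0
    change _ = _
    ext1
    simp

/-- The extension `𝒦_k R` of the `k`-th partial elimination ideal to `R`. -/
noncomputable def partialElimExt (p a : HomogeneousIdeal (grading n K)) (k : ℤ) :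
    HomogeneousIdeal (grading n K) where
  toSubmodule := (partialElim p a k).map (subalg p).val
  is_homogeneous' := by
    classical
    intro i b hb
    rw [Ideal.map] at hb
    induction hb using Submodule.span_induction generalizing i with
    | zero => simp
    | add => simp [*, Ideal.add_mem]
    | mem x hx =>
      obtain ⟨f, hf, rfl⟩ := hx
      exact Ideal.mem_map_of_mem (subalg p).val (proj_mem_partialElim p a k f hf i)
    | smul c x _ ih =>
      rw [smul_eq_mul, DirectSum.decompose_mul, DirectSum.coe_mul_apply]
      exact sum_mem fun ij _ => Ideal.mul_mem_left _ _ (ih _)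

end ProjectiveSpace

end SecantCone

open SecantCone

/-! Let `p = point v` and let `L` be the line joining `p` to a second point `w`. Everything rests on
one equivalence: the length of `Z ∩ L` is at least `k + 1` exactly when every element of the `k`-th
partial elimination ideal vanishes at `w`. Modulo the forms vanishing on `L`, the ring `R` becomes
`K[t, y]`, where `t` vanishes at `p` and `y` does not. A form `f` of degree `e` in `S` restricts to
`f(w) t ^ e`. If `f` lies in the `k`-th ideal and `f(w) ≠ 0`, the relation `y ^ k f + g ∈ I_Z`
restricts to a rule rewriting `t ^ e y ^ k` through lower powers of `y`. Since `p ∉ Z`, some `y ^ m`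
can also be rewritten. The two rules bound the dimension in all large degrees by `k`
(`finrank_quotGrading_le_of_mem_partialElimNat`). Conversely, if the length is at most `k`, the
monomials `t ^ (d - j) y ^ j` with `j ≤ k` are dependent in some degree `d ≥ k`. Over the point `w`,
where `t = 1`, this makes `1, …, y ^ (k - 1)` span the fibre of the `S`-module `R / I_Z`. That
module is finite because `p ∉ Z`, so Nakayama's lemma yields `r ∈ S` with `r(w) = 1` in the `k`-th
ideal (`exists_eval_ne_zero_of_linear_relation`). The passage from closed points to schemes uses the
Nullstellensatz (`closure_eq_of_forall_point_mem_iff`), the reducedness of quotients by radicals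
(`projQuotient_radical`), and the Galois connection between homogeneous ideals and closed
subschemes, which turns intersections into sums of ideals (`projQuotient_idealOf_sup`). -/

namespace SecantCone

/-! ### Ideal sheaves on `Proj` in the standard affine charts -/

section Charts

open HomogeneousLocalization CategoryTheory

variable {K A : Type u} [Field K] [CommRing A] [Algebra K A]
  (𝒜 : ℕ → Submodule K A) [GradedAlgebra 𝒜]

/-- The affine open subset `D₊(s)` of `Proj A`. -/
noncomputable abbrev chart {m : ℕ} {s : A} (hs : s ∈ 𝒜 m) (hm : 0 < m) : (Proj 𝒜).affineOpens :=
  ⟨Proj.basicOpen 𝒜 s, Proj.isAffineOpen_basicOpen 𝒜 s hs hm⟩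

/-- The ideal of a closed subscheme of `Proj A` in the coordinate ring of `D₊(s)`. -/
noncomputable def chartIdeal (Z : (Proj 𝒜).IdealSheafData) {m : ℕ} {s : A} (hs : s ∈ 𝒜 m)
    (hm : 0 < m) : Ideal (Away 𝒜 s) :=
  (Z.ideal (chart 𝒜 hs hm)).comap (Proj.awayToSection 𝒜 s).hom

theorem awayToSection_bijective {m : ℕ} {s : A} (hs : s ∈ 𝒜 m) (hm : 0 < m) :
    Function.Bijective (Proj.awayToSection 𝒜 s).hom := by
  rw [← Proj.basicOpenIsoAway_hom 𝒜 s hs hm]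
  exact ConcreteCategory.bijective_of_isIso (Proj.basicOpenIsoAway 𝒜 s hs hm).hom

theorem map_chartIdeal (Z : (Proj 𝒜).IdealSheafData) {m : ℕ} {s : A} (hs : s ∈ 𝒜 m)
    (hm : 0 < m) :
    (chartIdeal 𝒜 Z hs hm).map (Proj.awayToSection 𝒜 s).hom = Z.ideal (chart 𝒜 hs hm) :=
  Ideal.map_comap_of_surjective _ (awayToSection_bijective 𝒜 hs hm).2 _

/-- This is quasi-coherence for `D₊(sg) ⊆ D₊(s)`, transported to the rings of degree-zero fractions.
-/
theorem chartIdeal_awayMap (Z : (Proj 𝒜).IdealSheafData) {m m' : ℕ} {s g x : A} (hs : s ∈ 𝒜 m)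
    (hm : 0 < m) (hg : g ∈ 𝒜 m') (hx : x = s * g) (hxm : x ∈ 𝒜 (m + m')) :
    (chartIdeal 𝒜 Z hs hm).map (awayMap 𝒜 hg hx) =
      chartIdeal 𝒜 Z hxm (Nat.add_pos_left hm m') := by
  have key : ((chartIdeal 𝒜 Z hs hm).map (awayMap 𝒜 hg hx)).map (Proj.awayToSection 𝒜 x).hom =
      Z.ideal (chart 𝒜 hxm (Nat.add_pos_left hm m')) := by
    have h := congrArg CommRingCat.Hom.hom (Proj.awayMap_awayToSection 𝒜 (f := s) hg hx)
    rw [CommRingCat.hom_comp, CommRingCat.hom_comp, CommRingCat.hom_ofHom] at h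
    rw [Ideal.map_map, h, ← Ideal.map_map, map_chartIdeal]
    exact Z.map_ideal (U := chart 𝒜 hxm (Nat.add_pos_left hm m')) (V := chart 𝒜 hs hm)
      (Proj.basicOpen_mono 𝒜 _ _ ⟨_, hx⟩)
  conv_rhs => rw [chartIdeal, ← key]
  exact (Ideal.comap_map_of_bijective _
    (awayToSection_bijective 𝒜 hxm (Nat.add_pos_left hm m'))).symm

theorem le_iff_chartIdeal_le {ι : Type*} {m : ι → ℕ} {s : ι → A} (hs : ∀ i, s i ∈ 𝒜 (m i))
    (hm : ∀ i, 0 < m i)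
    (hcov : (HomogeneousIdeal.irrelevant 𝒜).toIdeal ≤ Ideal.span (Set.range s))
    {Z Z' : (Proj 𝒜).IdealSheafData} :
    Z ≤ Z' ↔ ∀ i, chartIdeal 𝒜 Z (hs i) (hm i) ≤ chartIdeal 𝒜 Z' (hs i) (hm i) := by
  refine ⟨fun h i => Ideal.comap_mono (h _), fun h => ?_⟩
  refine Scheme.IdealSheafData.le_of_iSup_eq_top (fun i => chart 𝒜 (hs i) (hm i))
    (Proj.iSup_basicOpen_eq_top 𝒜 s hcov) fun i => ?_
  rw [← map_chartIdeal, ← map_chartIdeal 𝒜 Z']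
  exact Ideal.map_mono (h i)

/-- Quasi-compactness lets the kernel ideal sheaf be computed on each affine open as the kernel on
sections. It holds because the preimage of `D₊(s)` is again a basic open set, so the morphism is
affine. -/
instance (J : HomogeneousIdeal 𝒜) :
    QuasiCompact (Proj.map (quotMap 𝒜 J) (irrelevant_le_map_quotMap 𝒜 J)) := by
  have : IsAffineHom (Proj.map (quotMap 𝒜 J) (irrelevant_le_map_quotMap 𝒜 J)) := by
    refine isAffineHom_of_forall_exists_isAffineOpen _ fun x => ?_
    have hx : ∃ (m : ℕ) (s : A), 0 < m ∧ s ∈ 𝒜 m ∧ s ∉ x.asHomogeneousIdeal := by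
      by_contra! h
      refine x.not_irrelevant_le ((HomogeneousIdeal.irrelevant_le 𝒜).mpr fun i hi a ha => ?_)
      exact h i a hi ha
    obtain ⟨m, s, hm, hs, hsx⟩ := hx
    refine ⟨Proj.basicOpen 𝒜 s, hsx, Proj.isAffineOpen_basicOpen 𝒜 s hs hm, ?_⟩
    rw [Proj.map_preimage_basicOpen]
    exact Proj.isAffineOpen_basicOpen _ _ ((quotMap 𝒜 J).map_mem hs) hm
  infer_instance

/-- On `D₊(s)` the immersion is the map of degree-zero localizations induced by `A → A ⧸ J`, and a
fraction dies there when a power of `s` kills its numerator modulo `J`. -/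
theorem mk_mem_chartIdeal_projQuotient (J : HomogeneousIdeal 𝒜) {m : ℕ} {s : A} (hs : s ∈ 𝒜 m)
    (hm : 0 < m) (n : ℕ) {a : A} (ha : a ∈ 𝒜 (n • m)) :
    Away.mk 𝒜 hs n a ha ∈ chartIdeal 𝒜 (projQuotient 𝒜 J) hs hm ↔ ∃ N, s ^ N * a ∈ J := by
  have h := congrArg CommRingCat.Hom.hom (Proj.awayToSection_comp_appLE (quotMap 𝒜 J)
    (irrelevant_le_map_quotMap 𝒜 J) hs)
  rw [CommRingCat.hom_comp, CommRingCat.hom_comp, CommRingCat.hom_ofHom] at h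
  rw [chartIdeal, projQuotient, Scheme.Hom.ker_apply]
  change (Scheme.Hom.app (Proj.map (quotMap 𝒜 J) (irrelevant_le_map_quotMap 𝒜 J))
      (chart 𝒜 hs hm).1).hom ((Proj.awayToSection 𝒜 s).hom (Away.mk 𝒜 hs n a ha)) = 0 ↔ _
  have h1 := DFunLike.congr_fun h (Away.mk 𝒜 hs n a ha)
  rw [RingHom.comp_apply, RingHom.comp_apply, Away.map_mk] at h1
  have h2 : (Scheme.Hom.app (Proj.map (quotMap 𝒜 J) (irrelevant_le_map_quotMap 𝒜 J))
      (chart 𝒜 hs hm).1).hom ((Proj.awayToSection 𝒜 s).hom (Away.mk 𝒜 hs n a ha)) =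
      (Proj.awayToSection (quotGrading 𝒜 J) (quotMap 𝒜 J s)).hom
        (Away.mk (quotGrading 𝒜 J) ((quotMap 𝒜 J).map_mem hs) n (quotMap 𝒜 J a)
          ((quotMap 𝒜 J).map_mem ha)) := by
    refine Eq.trans ?_ h1
    exact (DFunLike.congr_fun (congrArg CommRingCat.Hom.hom (Scheme.Hom.appLE_eq_app
      (f := Proj.map (quotMap 𝒜 J) (irrelevant_le_map_quotMap 𝒜 J))
      (U := (chart 𝒜 hs hm).1))) _).symm
  refine Iff.trans (b := Away.mk (quotGrading 𝒜 J) ((quotMap 𝒜 J).map_mem hs) n (quotMap 𝒜 J a)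
    ((quotMap 𝒜 J).map_mem ha) = 0) ⟨fun h0 => ?_, fun h0 => ?_⟩ ?_
  · exact (awayToSection_bijective (quotGrading 𝒜 J) ((quotMap 𝒜 J).map_mem hs) hm).1
      ((h2.symm.trans h0).trans (map_zero _).symm)
  · exact h2.trans ((congrArg _ h0).trans (map_zero _))
  rw [HomogeneousLocalization.ext_iff_val, Away.val_mk, val_zero,
    Localization.mk_eq_mk', IsLocalization.mk'_eq_zero_iff]
  constructor
  · rintro ⟨⟨_, N, rfl⟩, hN⟩
    refine ⟨N, ?_⟩
    have : quotMap 𝒜 J (s ^ N * a) = 0 := by simpa using hN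
    exact Ideal.Quotient.eq_zero_iff_mem.mp this
  · rintro ⟨N, hN⟩
    refine ⟨⟨_, N, rfl⟩, ?_⟩
    have : quotMap 𝒜 J (s ^ N * a) = 0 := Ideal.Quotient.eq_zero_iff_mem.mpr hN
    simpa using this

end Charts

/-! ### Homogeneous ideals and closed subschemes of `Proj` -/

section Correspondence

open HomogeneousLocalization CategoryTheory

variable {K A : Type u} [Field K] [CommRing A] [Algebra K A]
  (𝒜 : ℕ → Submodule K A) [GradedAlgebra 𝒜]

/-- The fraction `a / s ^ d` for `s` of degree one and `a` of degree `d`. -/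
def frac {s : A} (hs : s ∈ 𝒜 1) {d : ℕ} {a : A} (ha : a ∈ 𝒜 d) : Away 𝒜 s :=
  Away.mk 𝒜 hs d a (by simpa using ha)

@[simp]
theorem val_frac {s : A} (hs : s ∈ 𝒜 1) {d : ℕ} {a : A} (ha : a ∈ 𝒜 d) :
    (frac 𝒜 hs ha).val = Localization.mk a (⟨s ^ d, d, rfl⟩ : Submonoid.powers s) := rfl

theorem frac_surjective {s : A} (hs : s ∈ 𝒜 1) (z : Away 𝒜 s) :
    ∃ (d : ℕ) (a : A) (ha : a ∈ 𝒜 d), frac 𝒜 hs ha = z := by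
  obtain ⟨d, a, ha, rfl⟩ := Away.mk_surjective 𝒜 hs z
  exact ⟨d, a, by simpa using ha, rfl⟩

theorem frac_add {s : A} (hs : s ∈ 𝒜 1) {d : ℕ} {a b : A} (ha : a ∈ 𝒜 d) (hb : b ∈ 𝒜 d) :
    frac 𝒜 hs (add_mem ha hb) = frac 𝒜 hs ha + frac 𝒜 hs hb := by
  ext
  simp [Localization.add_mk_self]

theorem frac_mul {s : A} (hs : s ∈ 𝒜 1) {d e : ℕ} {a b : A} (ha : a ∈ 𝒜 d) (hb : b ∈ 𝒜 e)
    {f : ℕ} (hab : a * b ∈ 𝒜 f) (hf : d + e = f) :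
    frac 𝒜 hs hab = frac 𝒜 hs ha * frac 𝒜 hs hb := by
  subst hf
  ext
  simp only [val_frac, val_mul, Localization.mk_mul]
  congr 1
  ext
  simp [pow_add]

theorem frac_self {s : A} (hs : s ∈ 𝒜 1) {d : ℕ} (h : s ^ d ∈ 𝒜 d) : frac 𝒜 hs h = 1 := by
  ext
  simp only [val_frac, val_one]
  exact Localization.mk_self (⟨s ^ d, d, rfl⟩ : Submonoid.powers s)

theorem frac_mem_of_eq_zero {s : A} (hs : s ∈ 𝒜 1) {d : ℕ} {a : A} (ha : a ∈ 𝒜 d) (h : a = 0)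
    (I : Ideal (Away 𝒜 s)) : frac 𝒜 hs ha ∈ I := by
  have : frac 𝒜 hs ha = 0 := by
    ext
    simp [h, Localization.mk_zero]
  rw [this]
  exact zero_mem _

theorem pow_mem_grading {s : A} (hs : s ∈ 𝒜 1) (d : ℕ) : s ^ d ∈ 𝒜 d := by
  simpa using SetLike.pow_mem_graded (A := 𝒜) d hs

theorem frac_mem_chartIdeal_projQuotient (J : HomogeneousIdeal 𝒜) {s : A} (hs : s ∈ 𝒜 1) {d : ℕ}
    {a : A} (ha : a ∈ 𝒜 d) :
    frac 𝒜 hs ha ∈ chartIdeal 𝒜 (projQuotient 𝒜 J) hs one_pos ↔ ∃ N, s ^ N * a ∈ J :=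
  mk_mem_chartIdeal_projQuotient 𝒜 J hs one_pos d _

variable {ι : Type*} {s : ι → A} (hs : ∀ i, s i ∈ 𝒜 1)

/-- The homogeneous ideal of all `a` whose components vanish on `Z` in each chart `D₊(sᵢ)`. -/
noncomputable def sectionIdeal (Z : (Proj 𝒜).IdealSheafData) : HomogeneousIdeal 𝒜 where
  carrier := {a | ∀ d i, frac 𝒜 (hs i) (DirectSum.decompose 𝒜 a d).2 ∈
    chartIdeal 𝒜 Z (hs i) one_pos}
  add_mem' := by
    intro a b ha hb d i
    have := add_mem (ha d i) (hb d i)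
    rw [← frac_add] at this
    convert this using 2
    simp
  zero_mem' := by
    intro d i
    exact frac_mem_of_eq_zero 𝒜 _ _ (by simp) _
  smul_mem' := by
    classical
    intro c a ha d i
    -- `frac` carries a proof of homogeneity, so additivity is applied one summand at a time, over
    -- pairs of common total degree `d`.
    have key : ∀ F : Finset (ℕ × ℕ), (∀ x ∈ F, x.1 + x.2 = d) →
        ∀ h : (∑ x ∈ F, (DirectSum.decompose 𝒜 c x.1 * DirectSum.decompose 𝒜 a x.2 : A)) ∈ 𝒜 d,
          frac 𝒜 (hs i) h ∈ chartIdeal 𝒜 Z (hs i) one_pos := by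
      intro F
      induction F using Finset.induction_on with
      | empty =>
        exact fun _ h => frac_mem_of_eq_zero 𝒜 _ _ Finset.sum_empty _
      | insert x F hx ih =>
        intro hF h
        have hxd := hF x (Finset.mem_insert_self x F)
        have h1 : (DirectSum.decompose 𝒜 c x.1 * DirectSum.decompose 𝒜 a x.2 : A) ∈ 𝒜 d :=
          hxd ▸ SetLike.mul_mem_graded (DirectSum.decompose 𝒜 c x.1).2
            (DirectSum.decompose 𝒜 a x.2).2
        have h2 : (∑ x ∈ F, (DirectSum.decompose 𝒜 c x.1 * DirectSum.decompose 𝒜 a x.2 : A))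
            ∈ 𝒜 d := by
          rw [Finset.sum_insert hx] at h
          exact (Submodule.add_mem_iff_right _ h1).mp h
        have h3 := ih (fun x hx => hF x (Finset.mem_insert_of_mem hx)) h2
        have h4 := frac_mul 𝒜 (hs i) (DirectSum.decompose 𝒜 c x.1).2
            (DirectSum.decompose 𝒜 a x.2).2 h1 hxd
        have h5 := add_mem (h4 ▸ Ideal.mul_mem_left _ _ (ha x.2 i)) h3
        rw [← frac_add] at h5
        convert h5 using 2
        rw [Finset.sum_insert hx]
    have := key (((DirectSum.decompose 𝒜 c).support ×ˢ
      (DirectSum.decompose 𝒜 a).support).filter fun ij => ij.1 + ij.2 = d)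
      (fun x hx => (Finset.mem_filter.mp hx).2)
      (sum_mem fun x hx => (Finset.mem_filter.mp hx).2 ▸
        SetLike.mul_mem_graded (DirectSum.decompose 𝒜 c x.1).2 (DirectSum.decompose 𝒜 a x.2).2)
    convert this using 2
    rw [smul_eq_mul, DirectSum.decompose_mul, DirectSum.coe_mul_apply]
  is_homogeneous' := by
    classical
    intro j a ha d i
    by_cases h : j = d
    · subst h
      convert ha j i using 2
      exact DirectSum.decompose_of_mem_same 𝒜 (DirectSum.decompose 𝒜 a j).2
    · exact frac_mem_of_eq_zero 𝒜 _ _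
        (DirectSum.decompose_of_mem_ne 𝒜 (DirectSum.decompose 𝒜 a j).2 h) _

theorem mem_sectionIdeal_iff (Z : (Proj 𝒜).IdealSheafData) {d : ℕ} {a : A} (ha : a ∈ 𝒜 d) :
    a ∈ sectionIdeal 𝒜 hs Z ↔
      ∀ i, frac 𝒜 (hs i) ha ∈ chartIdeal 𝒜 Z (hs i) one_pos := by
  constructor
  · intro h i
    convert h d i using 2
    exact (DirectSum.decompose_of_mem_same 𝒜 ha).symm
  · intro h e i
    by_cases hd : d = e
    · subst hd
      convert h i using 2
      exact DirectSum.decompose_of_mem_same 𝒜 ha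
    · exact frac_mem_of_eq_zero 𝒜 _ _ (DirectSum.decompose_of_mem_ne 𝒜 ha hd) _

theorem homogeneousIdeal_le_iff (I J : HomogeneousIdeal 𝒜) :
    I ≤ J ↔ ∀ d, ∀ a ∈ 𝒜 d, a ∈ I → a ∈ J := by
  classical
  refine ⟨fun h d a _ ha => h ha, fun h a ha => ?_⟩
  rw [← DirectSum.sum_support_decompose 𝒜 a]
  exact J.toIdeal.sum_mem fun i _ => h i _ (DirectSum.decompose 𝒜 a i).2 (I.isHomogeneous i ha)

/-- Both sides can be tested on homogeneous elements; the power of `s i` needed to enter `J` is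
absorbed by `a / s ^ d = s ^ N a / s ^ (N + d)`. -/
theorem projQuotient_le_iff_le_sectionIdeal
    (hcov : (HomogeneousIdeal.irrelevant 𝒜).toIdeal ≤ Ideal.span (Set.range s))
    (J : HomogeneousIdeal 𝒜) (Z : (Proj 𝒜).IdealSheafData) :
    projQuotient 𝒜 J ≤ Z ↔ J ≤ sectionIdeal 𝒜 hs Z := by
  rw [le_iff_chartIdeal_le 𝒜 hs (fun _ => one_pos) hcov, homogeneousIdeal_le_iff]
  constructor
  · intro h d a ha haJ
    rw [mem_sectionIdeal_iff 𝒜 hs Z ha]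
    exact fun i => h i ((frac_mem_chartIdeal_projQuotient 𝒜 J (hs i) ha).mpr ⟨0, by simpa using haJ⟩)
  · intro h i z hz
    obtain ⟨d, a, ha, rfl⟩ := frac_surjective 𝒜 (hs i) z
    obtain ⟨N, hN⟩ := (frac_mem_chartIdeal_projQuotient 𝒜 J (hs i) ha).mp hz
    have hm : s i ^ N * a ∈ 𝒜 (N + d) := SetLike.mul_mem_graded (pow_mem_grading 𝒜 (hs i) N) ha
    have := (mem_sectionIdeal_iff 𝒜 hs Z hm).mp (h _ _ hm hN) i
    rwa [frac_mul 𝒜 (hs i) (pow_mem_grading 𝒜 (hs i) N) ha hm rfl, frac_self, one_mul] at this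

theorem idealOf_eq_sectionIdeal
    (hcov : (HomogeneousIdeal.irrelevant 𝒜).toIdeal ≤ Ideal.span (Set.range s))
    (Z : (Proj 𝒜).IdealSheafData) : idealOf 𝒜 Z = sectionIdeal 𝒜 hs Z := by
  apply le_antisymm
  · exact sSup_le fun J hJ => (projQuotient_le_iff_le_sectionIdeal 𝒜 hs hcov J Z).mp hJ
  · exact le_sSup ((projQuotient_le_iff_le_sectionIdeal 𝒜 hs hcov _ Z).mpr le_rfl)

include hs in
theorem gc_projQuotient_idealOf
    (hcov : (HomogeneousIdeal.irrelevant 𝒜).toIdeal ≤ Ideal.span (Set.range s)) :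
    GaloisConnection (projQuotient 𝒜) (idealOf 𝒜) := fun J Z => by
  rw [idealOf_eq_sectionIdeal 𝒜 hs hcov, projQuotient_le_iff_le_sectionIdeal 𝒜 hs hcov]

/-- On the overlap `D₊(xy)`, the localization of `D₊(y)` at `x / y`, the fraction `a / y ^ d` is a
multiple of `a / x ^ d` and hence vanishes on `Z`. Clearing denominators costs a power of `x / y`.
-/
theorem exists_pow_mul_frac_mem (Z : (Proj 𝒜).IdealSheafData) {x y : A} (hx : x ∈ 𝒜 1)
    (hy : y ∈ 𝒜 1) {d : ℕ} {a : A} (ha : a ∈ 𝒜 d)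
    (h : frac 𝒜 hx ha ∈ chartIdeal 𝒜 Z hx one_pos) :
    ∃ N, frac 𝒜 hy hx ^ N * frac 𝒜 hy ha ∈ chartIdeal 𝒜 Z hy one_pos := by
  have hxy : x * y ∈ 𝒜 (1 + 1) := SetLike.mul_mem_graded hx hy
  have h1 : awayMap 𝒜 hy rfl (frac 𝒜 hx ha) ∈ chartIdeal 𝒜 Z hxy two_pos := by
    rw [← chartIdeal_awayMap 𝒜 Z hx one_pos hy rfl hxy]
    exact Ideal.mem_map_of_mem _ h
  have hsq : x ^ (2 * d) ∈ 𝒜 (d • (1 + 1)) := by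
    rw [smul_eq_mul, mul_comm d]
    exact pow_mem_grading 𝒜 hx _
  -- The factor is `(x / y) ^ d`, written with denominator `(xy) ^ d`.
  have h2 : awayMap 𝒜 hx (mul_comm x y) (frac 𝒜 hy ha) =
      Away.mk 𝒜 hxy d (x ^ (2 * d)) hsq * awayMap 𝒜 hy rfl (frac 𝒜 hx ha) := by
    rw [frac, frac, awayMap_mk, awayMap_mk]
    ext
    simp only [val_mul, Away.val_mk, Localization.mk_mul]
    rw [Localization.mk_eq_mk_iff, Localization.r_iff_exists]
    refine ⟨1, ?_⟩
    simp only [Submonoid.coe_mul]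
    ring
  have h3 : awayMap 𝒜 hx (mul_comm x y) (frac 𝒜 hy ha) ∈
      (chartIdeal 𝒜 Z hy one_pos).map (awayMap 𝒜 hx (mul_comm x y)) := by
    rw [chartIdeal_awayMap 𝒜 Z hy one_pos hx (mul_comm x y) hxy, h2]
    exact Ideal.mul_mem_left _ _ h1
  let := (awayMap 𝒜 hx (mul_comm x y)).toAlgebra
  have hloc := Away.isLocalization_mul hy hx (mul_comm x y) one_ne_zero
  rw [← RingHom.algebraMap_toAlgebra (awayMap 𝒜 hx (mul_comm x y)),
    IsLocalization.algebraMap_mem_map_algebraMap_iff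
      (Submonoid.powers (Away.isLocalizationElem hy hx))] at h3
  obtain ⟨_, ⟨N, rfl⟩, hN⟩ := h3
  refine ⟨N, ?_⟩
  convert hN using 3
  ext
  simp

include hs in
theorem projQuotient_idealOf [Finite ι]
    (hcov : (HomogeneousIdeal.irrelevant 𝒜).toIdeal ≤ Ideal.span (Set.range s))
    (Z : (Proj 𝒜).IdealSheafData) : projQuotient 𝒜 (idealOf 𝒜 Z) = Z := by
  apply le_antisymm
  · exact (gc_projQuotient_idealOf 𝒜 hs hcov _ _).mpr le_rfl
  · rw [le_iff_chartIdeal_le 𝒜 hs (fun _ => one_pos) hcov]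
    intro i z hz
    obtain ⟨d, a, ha, rfl⟩ := frac_surjective 𝒜 (hs i) z
    rw [frac_mem_chartIdeal_projQuotient, idealOf_eq_sectionIdeal 𝒜 hs hcov]
    choose N hN using fun j => exists_pow_mul_frac_mem 𝒜 Z (hs i) (hs j) ha hz
    -- Finitely many charts allow one exponent for all of them, so that `s i ^ M * a` vanishes on
    -- `Z` everywhere.
    obtain ⟨M, hM⟩ := Set.Finite.bddAbove (Set.finite_range N)
    refine ⟨M, ?_⟩
    have hm : s i ^ M * a ∈ 𝒜 (M + d) := SetLike.mul_mem_graded (pow_mem_grading 𝒜 (hs i) M) ha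
    change _ ∈ sectionIdeal 𝒜 hs Z
    rw [mem_sectionIdeal_iff 𝒜 hs Z hm]
    intro j
    have hpow : frac 𝒜 (hs j) (pow_mem_grading 𝒜 (hs i) M) = frac 𝒜 (hs j) (hs i) ^ M := by
      ext
      simp only [val_frac, val_pow, Localization.mk_pow]
      congr 1
      ext
      simp
    rw [frac_mul 𝒜 (hs j) (pow_mem_grading 𝒜 (hs i) M) ha hm rfl, hpow,
      ← Nat.sub_add_cancel (hM ⟨j, rfl⟩), pow_add, mul_assoc]
    exact Ideal.mul_mem_left _ _ (hN j)

theorem mem_support_projQuotient (J : HomogeneousIdeal 𝒜) (x : Proj 𝒜) :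
    x ∈ (projQuotient 𝒜 J).support ↔ J ≤ x.asHomogeneousIdeal := by
  have hr : Set.range (Proj.map (quotMap 𝒜 J) (irrelevant_le_map_quotMap 𝒜 J)) =
      {x : Proj 𝒜 | J ≤ x.asHomogeneousIdeal} := by
    apply subset_antisymm
    · rintro _ ⟨y, rfl⟩ a ha
      change quotMap 𝒜 J a ∈ y.asHomogeneousIdeal
      have : quotMap 𝒜 J a = 0 := Ideal.Quotient.eq_zero_iff_mem.mpr ha
      rw [this]
      exact zero_mem _
    · intro x hx
      have hx' : J.toIdeal ≤ x.asHomogeneousIdeal.toIdeal := hx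
      have hcomap : (x.asHomogeneousIdeal.toIdeal.map (Ideal.Quotient.mk J.toIdeal)).comap
          (Ideal.Quotient.mk J.toIdeal) = x.asHomogeneousIdeal.toIdeal := by
        rw [Ideal.comap_map_of_surjective' _ Ideal.Quotient.mk_surjective, Ideal.mk_ker]
        exact sup_eq_left.mpr hx'
      have := x.isPrime
      refine ⟨⟨x.asHomogeneousIdeal.map (quotMap 𝒜 J), ?_, ?_⟩, ?_⟩
      · exact Ideal.map_isPrime_of_surjective (f := Ideal.Quotient.mk J.toIdeal)
          Ideal.Quotient.mk_surjective (by rwa [Ideal.mk_ker])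
      · intro h
        refine x.not_irrelevant_le ((HomogeneousIdeal.irrelevant_le 𝒜).mpr fun i hi a ha => ?_)
        have h1 : quotMap 𝒜 J a ∈ x.asHomogeneousIdeal.map (quotMap 𝒜 J) :=
          h (HomogeneousIdeal.mem_irrelevant_of_mem _ hi ((quotMap 𝒜 J).map_mem ha))
        exact hcomap.le h1
      · apply ProjectiveSpectrum.ext
        apply HomogeneousIdeal.toIdeal_injective
        exact hcomap
  have hc : IsClosed {x : Proj 𝒜 | J ≤ x.asHomogeneousIdeal} :=
    ProjectiveSpectrum.isClosed_zeroLocus 𝒜 (J : Set A)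
  rw [projQuotient, ← SetLike.mem_coe, Scheme.Hom.support_ker, hr]
  exact Set.ext_iff.mp hc.closure_eq x

include hs in
-- The quotient by a radical ideal is reduced: a nilpotent fraction already has a numerator in
-- `J.radical` up to a power of `s i`.
theorem projQuotient_radical
    (hcov : (HomogeneousIdeal.irrelevant 𝒜).toIdeal ≤ Ideal.span (Set.range s))
    (J : HomogeneousIdeal 𝒜) :
    projQuotient 𝒜 J.radical =
      Scheme.IdealSheafData.vanishingIdeal (projQuotient 𝒜 J.radical).support := by
  rw [Scheme.IdealSheafData.vanishingIdeal_support]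
  refine le_antisymm (Scheme.IdealSheafData.le_radical _) ?_
  rw [le_iff_chartIdeal_le 𝒜 hs (fun _ => one_pos) hcov]
  intro i z hz
  obtain ⟨d, a, ha, rfl⟩ := frac_surjective 𝒜 (hs i) z
  obtain ⟨n, hn⟩ := hz
  have hn' : frac 𝒜 (hs i) ha ^ n ∈ chartIdeal 𝒜 (projQuotient 𝒜 J.radical) (hs i) one_pos := by
    rw [chartIdeal]
    change (Proj.awayToSection 𝒜 (s i)).hom (frac 𝒜 (hs i) ha ^ n) ∈
      (projQuotient 𝒜 J.radical).ideal (chart 𝒜 (hs i) one_pos)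
    rw [map_pow]
    exact hn
  have hpow : frac 𝒜 (hs i) (SetLike.pow_mem_graded n ha) = frac 𝒜 (hs i) ha ^ n := by
    ext
    simp only [val_frac, val_pow, Localization.mk_pow]
    congr 1
    ext
    simp [← pow_mul, mul_comm]
  rw [← hpow, frac_mem_chartIdeal_projQuotient] at hn'
  rw [frac_mem_chartIdeal_projQuotient]
  obtain ⟨N, hN⟩ := hn'
  refine ⟨N, ?_⟩
  -- The exponent `n + 1` leaves a factor `s i ^ N` to pair with `a ^ n` even when `n = 0`.
  have : (s i ^ N * a) ^ (n + 1) ∈ J.radical := by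
    have e : (s i ^ N * a) ^ (n + 1) = (s i ^ N) ^ n * a * (s i ^ N * a ^ n) := by ring
    rw [e]
    exact Ideal.mul_mem_left _ _ hN
  exact Ideal.radical_isRadical J.toIdeal ⟨n + 1, this⟩

end Correspondence

/-! ### Closed points of projective space and the Nullstellensatz -/

section Points

variable {n : ℕ} {K : Type u} [Field K]

theorem X_mem_grading (i : Fin (n + 1)) : (X i : MvPolynomial (Fin (n + 1)) K) ∈ grading n K 1 :=
  isHomogeneous_X K i

theorem aeval_mul_of_mem_grading {B : Type*} [CommRing B] [Algebra K B] {d : ℕ}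
    {f : MvPolynomial (Fin (n + 1)) K} (hf : f ∈ grading n K d) (c : B) (w : Fin (n + 1) → B) :
    aeval (fun i => c * w i) f = c ^ d * aeval w f := by
  rw [aeval_def, aeval_def, eval₂_eq', eval₂_eq', Finset.mul_sum]
  refine Finset.sum_congr rfl fun m hm => ?_
  have hd : ∑ i, m i = d := by
    rw [← hf (mem_support_iff.mp hm), Finsupp.weight_apply, Finsupp.sum_fintype] <;> simp
  simp only [mul_pow, Finset.prod_mul_distrib, Finset.prod_pow_eq_pow_sum, hd]
  ring

theorem irrelevant_le_span_X :
    (HomogeneousIdeal.irrelevant (grading n K)).toIdeal ≤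
      Ideal.span (Set.range (X : Fin (n + 1) → MvPolynomial (Fin (n + 1)) K)) := by
  rw [HomogeneousIdeal.toIdeal_irrelevant_le]
  intro i hi f hf
  change f ∈ Ideal.span (Set.range (X : Fin (n + 1) → MvPolynomial (Fin (n + 1)) K))
  rw [← Set.image_univ, mem_ideal_span_X_image]
  intro m hm
  have hd : m.degree = i := by
    rw [← hf (mem_support_iff.mp hm), Finsupp.degree_eq_weight_one]
    rfl
  by_contra! h
  have : m = 0 := by
    ext j
    exact h j (Set.mem_univ j)
  rw [this, map_zero] at hd
  omega

theorem exists_X_notMem (x : ProjSpace n K) :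
    ∃ i, (X i : MvPolynomial (Fin (n + 1)) K) ∉ x.asHomogeneousIdeal := by
  by_contra! h
  refine x.not_irrelevant_le (irrelevant_le_span_X.trans (Ideal.span_le.mpr ?_))
  rintro _ ⟨i, rfl⟩
  exact h i

/-- The closed point of `ℙⁿ` with homogeneous coordinates `v`. -/
noncomputable def point (v : Fin (n + 1) → K) (hv : v ≠ 0) : ProjSpace n K where
  asHomogeneousIdeal := (RingHom.ker (eval v)).homogeneousCore (grading n K)
  isPrime := (RingHom.ker_isPrime (eval v)).homogeneousCore
  not_irrelevant_le h := by
    obtain ⟨i, hi⟩ := Function.ne_iff.mp hv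
    have h1 := Ideal.toIdeal_homogeneousCore_le (grading n K) _
      (h (HomogeneousIdeal.mem_irrelevant_of_mem _ one_pos (X_mem_grading i)))
    rw [RingHom.mem_ker, eval_X] at h1
    exact hi h1

theorem eval_eq_zero_of_mem_point {v : Fin (n + 1) → K} {hv : v ≠ 0}
    {f : MvPolynomial (Fin (n + 1)) K} (hf : f ∈ (point v hv).asHomogeneousIdeal) :
    eval v f = 0 :=
  Ideal.toIdeal_homogeneousCore_le (grading n K) _ hf

theorem mem_point_iff {v : Fin (n + 1) → K} {hv : v ≠ 0} {d : ℕ}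
    {f : MvPolynomial (Fin (n + 1)) K} (hf : f ∈ grading n K d) :
    f ∈ (point v hv).asHomogeneousIdeal ↔ eval v f = 0 :=
  ⟨eval_eq_zero_of_mem_point, fun h => Ideal.mem_homogeneousCore_of_homogeneous_of_mem ⟨d, hf⟩ h⟩

theorem le_point_iff {v : Fin (n + 1) → K} {hv : v ≠ 0} {J : HomogeneousIdeal (grading n K)} :
    J ≤ (point v hv).asHomogeneousIdeal ↔ ∀ f ∈ J, eval v f = 0 :=
  (Ideal.homogeneousCore.gc (grading n K) J _).symm

theorem mem_closure_singleton_iff (x y : ProjSpace n K) :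
    y ∈ closure {x} ↔ x.asHomogeneousIdeal ≤ y.asHomogeneousIdeal :=
  (ProjectiveSpectrum.le_iff_mem_closure (grading n K) x y).symm

/-- Suppose a larger relevant prime contained a form `f` with `f(v) ≠ 0`. Since `v i ^ d f - f(v) X
i ^ d` vanishes at `v`, the prime would contain a variable `X i` with `v i ≠ 0`, and then, through
`v j X i - v i X j`, every variable. -/
theorem isClosed_point (v : Fin (n + 1) → K) (hv : v ≠ 0) : IsClosed {point v hv} := by
  rw [← closure_subset_iff_isClosed]
  intro x hx
  rw [mem_closure_singleton_iff] at hx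
  refine ProjectiveSpectrum.ext (le_antisymm ?_ hx)
  rw [homogeneousIdeal_le_iff]
  intro d f hf hfx
  rw [mem_point_iff hf]
  by_contra h0
  obtain ⟨i, hi⟩ := Function.ne_iff.mp hv
  obtain ⟨j, hj⟩ := exists_X_notMem x
  refine hj ?_
  have := x.isPrime
  have hX : ∀ i, v i ≠ 0 → (X i : MvPolynomial (Fin (n + 1)) K) ∈ x.asHomogeneousIdeal := by
    intro i hi
    have h1 : C (v i ^ d) * f - C (eval v f) * X i ^ d ∈ grading n K d := by
      refine sub_mem ?_ ?_
      · rw [← smul_eq_C_mul]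
        exact Submodule.smul_mem _ _ hf
      · rw [← smul_eq_C_mul]
        exact Submodule.smul_mem _ _ (pow_mem_grading _ (X_mem_grading i) d)
    have h2 := hx ((mem_point_iff (v := v) (hv := hv) h1).mpr (by simp [mul_comm]))
    have h3 : C (eval v f) * X i ^ d ∈ x.asHomogeneousIdeal.toIdeal := by
      rw [← Submodule.sub_mem_iff_right (p := x.asHomogeneousIdeal.toIdeal)
        (Ideal.mul_mem_left _ (C (v i ^ d)) hfx)]
      exact h2
    have h4 : C (eval v f)⁻¹ * (C (eval v f) * X i ^ d) ∈ x.asHomogeneousIdeal.toIdeal :=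
      Ideal.mul_mem_left _ _ h3
    rw [← mul_assoc, ← C_mul, inv_mul_cancel₀ h0, C_1, one_mul] at h4
    exact this.mem_of_pow_mem d h4
  have h1 : C (v j) * X i - C (v i) * X j ∈ grading n K 1 := by
    refine sub_mem ?_ ?_ <;>
    · rw [← smul_eq_C_mul]
      exact Submodule.smul_mem _ _ (X_mem_grading _)
  have h2 := hx ((mem_point_iff (v := v) (hv := hv) h1).mpr (by simp [mul_comm]))
  have h3 : C (v i) * X j ∈ x.asHomogeneousIdeal.toIdeal := by
    rw [← Submodule.sub_mem_iff_right (p := x.asHomogeneousIdeal.toIdeal)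
      (Ideal.mul_mem_left _ (C (v j)) (hX i hi))]
    exact h2
  have h4 : C (v i)⁻¹ * (C (v i) * X j) ∈ x.asHomogeneousIdeal.toIdeal :=
    Ideal.mul_mem_left _ _ h3
  rwa [← mul_assoc, ← C_mul, inv_mul_cancel₀ hi, C_1, one_mul] at h4

theorem exists_point_of_notMem [IsAlgClosed K] (x : ProjSpace n K)
    {f : MvPolynomial (Fin (n + 1)) K} (hf : f ∉ x.asHomogeneousIdeal) :
    ∃ (v : Fin (n + 1) → K) (hv : v ≠ 0),
      x.asHomogeneousIdeal ≤ (point v hv).asHomogeneousIdeal ∧ eval v f ≠ 0 := by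
  obtain ⟨i, hi⟩ := exists_X_notMem x
  have := x.isPrime
  -- The extra factor `X i` keeps the affine zero supplied by the Nullstellensatz away from the
  -- origin.
  have h : f * X i ∉ x.asHomogeneousIdeal.toIdeal := fun h =>
    (this.mem_or_mem h).elim hf hi
  rw [← MvPolynomial.IsPrime.vanishingIdeal_zeroLocus (K := K) x.asHomogeneousIdeal.toIdeal,
    mem_vanishingIdeal_iff] at h
  push Not at h
  obtain ⟨v, hv, hfv⟩ := h
  rw [aeval_eq_eval] at hfv
  change eval v (f * X i) ≠ 0 at hfv
  rw [map_mul, eval_X] at hfv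
  refine ⟨v, fun h0 => hfv (by simp [h0]), le_point_iff.mpr fun g hg => ?_, left_ne_zero_of_mul hfv⟩
  simpa [aeval_eq_eval] using hv g hg

theorem exists_eq_point [IsAlgClosed K] {x : ProjSpace n K} (hx : IsClosed {x}) :
    ∃ (v : Fin (n + 1) → K) (hv : v ≠ 0), x = point v hv := by
  have h1 : (1 : MvPolynomial (Fin (n + 1)) K) ∉ x.asHomogeneousIdeal := fun h =>
    x.isPrime.ne_top ((Ideal.eq_top_iff_one _).mpr h)
  obtain ⟨v, hv, h, -⟩ := exists_point_of_notMem x h1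
  refine ⟨v, hv, ?_⟩
  have := (mem_closure_singleton_iff x (point v hv)).mpr h
  rw [hx.closure_eq] at this
  exact (Set.mem_singleton_iff.mp this).symm

/-- Closed points are dense in every `V(J)`: any form missing from a prime above `J` is nonzero at
some closed point of that prime's closure. -/
theorem closure_eq_of_forall_point_mem_iff [IsAlgClosed K] (J : HomogeneousIdeal (grading n K))
    (T : Set (ProjSpace n K)) (hT : ∀ x ∈ T, J ≤ x.asHomogeneousIdeal)
    (hT' : ∀ v hv, J ≤ (point v hv).asHomogeneousIdeal → point v hv ∈ T) :
    closure T = {x : ProjSpace n K | J ≤ x.asHomogeneousIdeal} := by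
  apply subset_antisymm
  · exact closure_minimal hT (ProjectiveSpectrum.isClosed_zeroLocus (grading n K)
      (J : Set (MvPolynomial (Fin (n + 1)) K)))
  · intro x hx
    by_contra h
    have h' : ∃ f, f ∉ x.asHomogeneousIdeal ∧ ∀ y ∈ T, f ∈ y.asHomogeneousIdeal := by
      by_contra! h1
      refine h ?_
      refine (ProjectiveSpectrum.zeroLocus_vanishingIdeal_eq_closure (grading n K) T).le ?_
      intro f hf
      by_contra hfx
      obtain ⟨y, hy, hfy⟩ := h1 f hfx
      exact hfy ((ProjectiveSpectrum.mem_vanishingIdeal T f).mp hf y hy)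
    obtain ⟨f, hfx, hfT⟩ := h'
    obtain ⟨v, hv, hxv, hfv⟩ := exists_point_of_notMem x hfx
    exact hfv (eval_eq_zero_of_mem_point (hfT _ (hT' v hv (hx.trans hxv))))

theorem point_eq_point_of_smul {v w : Fin (n + 1) → K} (hv : v ≠ 0) (hw : w ≠ 0) (c : K)
    (h : v = c • w) : point v hv = point w hw := by
  have hc : c ≠ 0 := by
    rintro rfl
    exact hv (by simpa using h)
  apply ProjectiveSpectrum.ext
  apply le_antisymm <;>
  · rw [homogeneousIdeal_le_iff]
    intro d f hf
    rw [mem_point_iff hf, mem_point_iff hf, h]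
    have : eval (c • w) f = c ^ d * eval w f := aeval_mul_of_mem_grading hf c w
    simp [this, hc]

end Points

/-! ### The degree filtration of `R = S[y]` and partial elimination ideals -/

section Elimination

variable {n : ℕ} {K : Type u} [Field K]

theorem aeval_add_mul_of_mem_grading_one {B : Type*} [CommRing B] [Algebra K B]
    {f : MvPolynomial (Fin (n + 1)) K} (hf : f ∈ grading n K 1) (w w' : Fin (n + 1) → B) (c : B) :
    aeval (fun i => w i + c * w' i) f = aeval w f + c * aeval w' f := by
  rw [grading, homogeneousSubmodule_one_eq_span_X] at hf
  induction hf using Submodule.span_induction with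
  | mem x hx =>
    obtain ⟨i, rfl⟩ := hx
    simp
  | zero => simp
  | add x y _ _ hx hy =>
    rw [map_add, map_add, map_add, hx, hy]
    ring
  | smul a x _ hx =>
    rw [map_smul, map_smul, map_smul, hx, smul_add, mul_smul_comm]

theorem degLT_mono (p : HomogeneousIdeal (grading n K)) (y : MvPolynomial (Fin (n + 1)) K)
    {k l : ℕ} (h : k ≤ l) : degLT p y k ≤ degLT p y l :=
  Submodule.span_mono fun _ ⟨i, hi, e⟩ => ⟨i, hi.trans_le h, e⟩

theorem pow_mem_degLT (p : HomogeneousIdeal (grading n K)) (y : MvPolynomial (Fin (n + 1)) K)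
    {i k : ℕ} (h : i < k) : y ^ i ∈ degLT p y k :=
  Submodule.subset_span ⟨i, h, rfl⟩

theorem mul_mem_degLT (p : HomogeneousIdeal (grading n K)) (y : MvPolynomial (Fin (n + 1)) K)
    {k : ℕ} {s g : MvPolynomial (Fin (n + 1)) K} (hs : s ∈ subalg p) (hg : g ∈ degLT p y k) :
    s * g ∈ degLT p y k :=
  Submodule.smul_mem (degLT p y k) (⟨s, hs⟩ : subalg p) hg

theorem C_mem_subalg (p : HomogeneousIdeal (grading n K)) (c : K) : C c ∈ subalg p :=
  (subalg p).algebraMap_mem c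

theorem self_mul_mem_degLT (p : HomogeneousIdeal (grading n K))
    (y : MvPolynomial (Fin (n + 1)) K) {k : ℕ} {g : MvPolynomial (Fin (n + 1)) K}
    (hg : g ∈ degLT p y k) : y * g ∈ degLT p y (k + 1) := by
  induction hg using Submodule.span_induction with
  | mem x hx =>
    obtain ⟨i, hi, rfl⟩ := hx
    rw [← pow_succ']
    exact pow_mem_degLT p y (Nat.succ_lt_succ hi)
  | zero => simp
  | add a b _ _ ha hb =>
    rw [mul_add]
    exact add_mem ha hb
  | smul s x _ hx =>
    rw [mul_smul_comm]
    exact Submodule.smul_mem _ _ hx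

variable {v : Fin (n + 1) → K} {hv : v ≠ 0}

theorem mem_subalg_of_eval_eq_zero {f : MvPolynomial (Fin (n + 1)) K} (hf : f ∈ grading n K 1)
    (h : eval v f = 0) : f ∈ subalg (point v hv).asHomogeneousIdeal :=
  Algebra.subset_adjoin ⟨(mem_point_iff hf).mpr h, hf⟩

/-- The generators of `S` are linear and vanish at `v`, so elements of `S` are invariant under
translation along `v`: they are functions on the projection from `p`. -/
theorem aeval_add_mul_of_mem_subalg {B : Type*} [CommRing B] [Algebra K B]
    {f : MvPolynomial (Fin (n + 1)) K} (hf : f ∈ subalg (point v hv).asHomogeneousIdeal)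
    (w : Fin (n + 1) → B) (c : B) :
    aeval (fun i => w i + c * algebraMap K B (v i)) f = aeval w f := by
  induction hf using Algebra.adjoin_induction with
  | mem x hx =>
    rw [aeval_add_mul_of_mem_grading_one hx.2]
    have : aeval (fun i => algebraMap K B (v i)) x = algebraMap K B (eval v x) :=
      (aeval_algebraMap_apply B v x).trans (by rw [aeval_eq_eval])
    rw [this, (mem_point_iff hx.2).mp hx.1, map_zero, mul_zero, add_zero]
  | algebraMap r => simp
  | add x y _ _ hx hy => rw [map_add, map_add, hx, hy]
  | mul x y _ _ hx hy => rw [map_mul, map_mul, hx, hy]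

theorem eval_add_smul_of_mem_subalg {f : MvPolynomial (Fin (n + 1)) K}
    (hf : f ∈ subalg (point v hv).asHomogeneousIdeal) (w : Fin (n + 1) → K) (c : K) :
    eval (w + c • v) f = eval w f := by
  have := aeval_add_mul_of_mem_subalg hf w c
  simp only [aeval_eq_eval] at this
  exact this

/-- Each linear form `l` is `(l(v) / y(v)) y` plus an element of `S`; in a product of `d` such forms
the coefficient of `y ^ d` is therefore a constant, read off at `v`. -/
theorem sub_mem_degLT {y : MvPolynomial (Fin (n + 1)) K} (hy : y ∈ grading n K 1)
    (hyv : eval v y ≠ 0) {d : ℕ} {f : MvPolynomial (Fin (n + 1)) K} (hf : f ∈ grading n K d) :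
    f - C (eval v f / eval v y ^ d) * y ^ d ∈ degLT (point v hv).asHomogeneousIdeal y d := by
  rw [grading, ← homogeneousSubmodule_one_pow] at hf
  induction hf using Submodule.pow_induction_on_left' with
  | algebraMap r => simp
  | add f g d _ _ hf hg =>
    convert add_mem hf hg using 1
    rw [map_add, add_div, C_add]
    ring
  | mem_mul l hl d f _ ih =>
    have hs : l - C (eval v l / eval v y) * y ∈ subalg (point v hv).asHomogeneousIdeal := by
      apply mem_subalg_of_eval_eq_zero
      · refine sub_mem hl ?_
        rw [← smul_eq_C_mul]
        exact Submodule.smul_mem _ _ hy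
      · simp [hyv]
    have h1 := mul_mem_degLT _ y hs (degLT_mono _ y d.le_succ ih)
    have h2 := mul_mem_degLT _ y (C_mem_subalg _ (eval v l / eval v y)) (self_mul_mem_degLT _ y ih)
    have h3 := mul_mem_degLT _ y (mul_mem hs (C_mem_subalg _ (eval v f / eval v y ^ d)))
      (pow_mem_degLT _ y d.lt_succ_self)
    convert add_mem (add_mem h1 h2) h3 using 1
    have : C (eval v (l * f) / eval v y ^ (d + 1)) =
        (C (eval v l / eval v y) * C (eval v f / eval v y ^ d) :
          MvPolynomial (Fin (n + 1)) K) := by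
      rw [← C_mul, map_mul, pow_succ']
      congr 1
      field_simp
    rw [this, pow_succ]
    ring

theorem grading_le_degLT {y : MvPolynomial (Fin (n + 1)) K} (hy : y ∈ grading n K 1)
    (hyv : eval v y ≠ 0) {d : ℕ} {f : MvPolynomial (Fin (n + 1)) K} (hf : f ∈ grading n K d) :
    f ∈ degLT (point v hv).asHomogeneousIdeal y (d + 1) := by
  have h1 := degLT_mono _ y d.le_succ (sub_mem_degLT (hv := hv) hy hyv hf)
  have h2 := mul_mem_degLT _ y (C_mem_subalg (point v hv).asHomogeneousIdeal
    (eval v f / eval v y ^ d)) (pow_mem_degLT _ y d.lt_succ_self)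
  simpa using add_mem h1 h2

theorem degLT_le_degLT {y y' : MvPolynomial (Fin (n + 1)) K} (hy : y ∈ grading n K 1)
    (hy' : y' ∈ grading n K 1) (hyv : eval v y' ≠ 0) (k : ℕ) :
    degLT (point v hv).asHomogeneousIdeal y k ≤ degLT (point v hv).asHomogeneousIdeal y' k := by
  refine Submodule.span_le.mpr ?_
  rintro _ ⟨i, hi, rfl⟩
  exact degLT_mono _ y' hi (grading_le_degLT hy' hyv (pow_mem_grading _ hy i))

theorem exists_mem_degLT {y : MvPolynomial (Fin (n + 1)) K} (hy : y ∈ grading n K 1)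
    (hyv : eval v y ≠ 0) (f : MvPolynomial (Fin (n + 1)) K) :
    ∃ k, f ∈ degLT (point v hv).asHomogeneousIdeal y k := by
  classical
  refine ⟨f.totalDegree + 1, ?_⟩
  suffices h : ∑ i ∈ Finset.range (f.totalDegree + 1), homogeneousComponent i f ∈
      degLT (point v hv).asHomogeneousIdeal y (f.totalDegree + 1) by
    rwa [sum_homogeneousComponent] at h
  refine sum_mem fun i hi => ?_
  exact degLT_mono _ y (Nat.succ_le_succ (Nat.lt_succ_iff.mp (Finset.mem_range.mp hi)))
    (grading_le_degLT hy hyv (homogeneousComponent_mem i f))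

/-- One choice of `y` suffices, because `y' ^ k` is a constant times `y ^ k` modulo lower terms and
the filtration does not depend on `y`. -/
theorem mem_partialElimNat_of_exists {a : HomogeneousIdeal (grading n K)} {k : ℕ}
    {f : subalg (point v hv).asHomogeneousIdeal} {y : MvPolynomial (Fin (n + 1)) K}
    (hy : y ∈ grading n K 1) (hyv : eval v y ≠ 0)
    (h : ∃ g ∈ degLT (point v hv).asHomogeneousIdeal y k, y ^ k * f + g ∈ a) :
    f ∈ partialElimNat (point v hv).asHomogeneousIdeal a k := by
  intro y' hy' hyp
  obtain ⟨g, hg, hga⟩ := h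
  rw [mem_point_iff hy'] at hyp
  set c := eval v (y' ^ k) / eval v y ^ k
  have h1 : y' ^ k - C c * y ^ k ∈ degLT (point v hv).asHomogeneousIdeal y k :=
    sub_mem_degLT hy hyv (pow_mem_grading _ hy' k)
  refine ⟨C c * g - (f : MvPolynomial (Fin (n + 1)) K) * (y' ^ k - C c * y ^ k), ?_, ?_⟩
  · exact degLT_le_degLT hy hy' hyp k
      (sub_mem (mul_mem_degLT _ y (C_mem_subalg _ c) hg) (mul_mem_degLT _ y f.2 h1))
  · have : y' ^ k * (f : MvPolynomial (Fin (n + 1)) K) +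
        (C c * g - (f : MvPolynomial (Fin (n + 1)) K) * (y' ^ k - C c * y ^ k)) =
        C c * (y ^ k * (f : MvPolynomial (Fin (n + 1)) K) + g) := by ring
    rw [this]
    exact a.toIdeal.mul_mem_left _ hga

variable (v) in
theorem exists_linear_eval_ne_zero (hv : v ≠ 0) :
    ∃ y ∈ grading n K 1, eval v y ≠ 0 := by
  obtain ⟨i, hi⟩ := Function.ne_iff.mp hv
  exact ⟨X i, X_mem_grading i, by simpa using hi⟩

/-- A form in `a` that does not vanish at `p` is, up to a scalar, monic in `y`. This is where `p ∉
Z` enters. -/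
theorem exists_one_mem_partialElimNat {a : HomogeneousIdeal (grading n K)}
    (ha : ¬ a ≤ (point v hv).asHomogeneousIdeal) :
    ∃ m, (1 : subalg (point v hv).asHomogeneousIdeal) ∈
      partialElimNat (point v hv).asHomogeneousIdeal a m := by
  rw [homogeneousIdeal_le_iff] at ha
  push Not at ha
  obtain ⟨m, F, hF, hFa, hFv⟩ := ha
  rw [mem_point_iff hF] at hFv
  obtain ⟨y, hy, hyv⟩ := exists_linear_eval_ne_zero v hv
  refine ⟨m, mem_partialElimNat_of_exists hy hyv ?_⟩
  set c := eval v F / eval v y ^ m with hc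
  have hc0 : c ≠ 0 := div_ne_zero hFv (pow_ne_zero _ hyv)
  refine ⟨C c⁻¹ * (F - C c * y ^ m),
    mul_mem_degLT _ y (C_mem_subalg _ _) (sub_mem_degLT hy hyv hF), ?_⟩
  have : y ^ m * ((1 : subalg (point v hv).asHomogeneousIdeal) : MvPolynomial (Fin (n + 1)) K) +
      C c⁻¹ * (F - C c * y ^ m) = C c⁻¹ * F := by
    rw [mul_sub, ← mul_assoc (C c⁻¹), ← C_mul, inv_mul_cancel₀ hc0]
    simp
  rw [this]
  exact a.toIdeal.mul_mem_left _ hFa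

theorem eval_eq_zero_of_mem_partialElim {a : HomogeneousIdeal (grading n K)} {k : ℤ}
    (h : partialElim (point v hv).asHomogeneousIdeal a k ≠ ⊤)
    {f : subalg (point v hv).asHomogeneousIdeal}
    (hf : f ∈ partialElim (point v hv).asHomogeneousIdeal a k) : eval v (f : MvPolynomial _ K) = 0 := by
  by_contra h0
  apply h
  have h1 : eval (0 : Fin (n + 1) → K) (f : MvPolynomial (Fin (n + 1)) K) ≠ 0 := by
    -- An element of `S` takes the same value at `v` and at the origin, so `f(v)` is its constant
    -- term. A nonzero one would put a unit in the graded ideal.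
    rw [← eval_add_smul_of_mem_subalg f.2 0 1]
    simpa using h0
  have h2 := proj_mem_partialElim _ a k f hf 0
  have h3 : (DirectSum.decompose (grading n K) (f : MvPolynomial (Fin (n + 1)) K) 0 :
      MvPolynomial (Fin (n + 1)) K) = C (eval 0 (f : MvPolynomial (Fin (n + 1)) K)) := by
    have : (DirectSum.decompose (grading n K) (f : MvPolynomial (Fin (n + 1)) K) 0 :
      MvPolynomial (Fin (n + 1)) K) = homogeneousComponent 0 (f : MvPolynomial (Fin (n + 1)) K) :=
      decomposition.decompose'_apply _ _
    rw [this, homogeneousComponent_zero]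
    rw [eval_zero, constantCoeff_eq]
  rw [Ideal.eq_top_iff_one]
  have h4 := (partialElim (point v hv).asHomogeneousIdeal a k).mul_mem_left
    (algebraMap K _ (eval 0 (f : MvPolynomial (Fin (n + 1)) K))⁻¹) h2
  convert h4 using 1
  apply Subtype.ext
  simp only [OneMemClass.coe_one, MulMemClass.coe_mul, h3]
  change 1 = C _ * C _
  rw [← C_mul, inv_mul_cancel₀ h1, C_1]

end Elimination

/-! ### Lines as two-dimensional subspaces of the coordinate space -/

section Lines

variable {n : ℕ} {K : Type u} [Field K]

variable (n K) in
/-- The linear form given by a functional on the space of homogeneous coordinates. -/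
noncomputable def toForm :
    Module.Dual K (Fin (n + 1) → K) →ₗ[K] MvPolynomial (Fin (n + 1)) K where
  toFun φ := ∑ i, φ (Pi.single i 1) • X i
  map_add' φ ψ := by simp [add_smul, Finset.sum_add_distrib]
  map_smul' c φ := by simp [Finset.smul_sum, mul_smul]

theorem eval_toForm (φ : Module.Dual K (Fin (n + 1) → K)) (v : Fin (n + 1) → K) :
    eval v (toForm n K φ) = φ v := by
  conv_rhs => rw [← Finset.univ_sum_single v, map_sum]
  simp only [toForm, LinearMap.coe_mk, AddHom.coe_mk, map_sum, smul_eval, eval_X]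
  refine Finset.sum_congr rfl fun i _ => ?_
  rw [mul_comm, ← smul_eq_mul, ← map_smul, ← Pi.single_smul, smul_eq_mul, mul_one]

theorem toForm_mem_grading (φ : Module.Dual K (Fin (n + 1) → K)) : toForm n K φ ∈ grading n K 1 :=
  sum_mem fun i _ => Submodule.smul_mem _ _ (X_mem_grading i)

theorem toForm_injective : Function.Injective (toForm n K) := fun φ ψ h => by
  ext i
  simp only [LinearMap.coe_comp, LinearMap.coe_single, Function.comp_apply]
  rw [← eval_toForm, h, eval_toForm]

theorem exists_toForm_eq {f : MvPolynomial (Fin (n + 1)) K} (hf : f ∈ grading n K 1) :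
    ∃ φ, toForm n K φ = f := by
  suffices h : grading n K 1 ≤ LinearMap.range (toForm n K) from h hf
  rw [grading, homogeneousSubmodule_one_eq_span_X, Submodule.span_le]
  rintro _ ⟨i, rfl⟩
  refine ⟨LinearMap.proj i, ?_⟩
  simp [toForm, Pi.single_apply]

theorem finrank_span_pair {v w : Fin (n + 1) → K} (hv : v ≠ 0) (hw : w ∉ Submodule.span K {v}) :
    Module.finrank K (Submodule.span K {v, w}) = 2 := by
  have h : LinearIndependent K ![v, w] := by
    rw [LinearIndependent.pair_iff' hv]
    intro a ha
    exact hw (Submodule.mem_span_singleton.mpr ⟨a, ha⟩)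
  have := finrank_span_eq_card h
  rwa [Matrix.range_cons, Matrix.range_cons, Matrix.range_empty, Set.union_empty,
    Set.singleton_union, Fintype.card_fin] at this

theorem exists_line {v w : Fin (n + 1) → K} (hv : v ≠ 0) (hw : w ∉ Submodule.span K {v}) :
    ∃ L : Line n K, ∀ f ∈ grading n K 1, f ∈ L.forms ↔ eval v f = 0 ∧ eval w f = 0 := by
  have h := Subspace.finrank_add_finrank_dualAnnihilator_eq (Submodule.span K {v, w})
  rw [finrank_span_pair hv hw, Module.finrank_fin_fun] at h
  refine ⟨⟨(Submodule.span K {v, w}).dualAnnihilator.map (toForm n K), ?_, ?_⟩, ?_⟩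
  · rintro _ ⟨φ, -, rfl⟩
    exact toForm_mem_grading φ
  · rw [← (Submodule.equivMapOfInjective _ toForm_injective _).finrank_eq]
    omega
  · intro f hf
    obtain ⟨φ, rfl⟩ := exists_toForm_eq hf
    change toForm n K φ ∈ (Submodule.span K {v, w}).dualAnnihilator.map (toForm n K) ↔ _
    rw [← SetLike.mem_coe, Submodule.map_coe, toForm_injective.mem_set_image, SetLike.mem_coe,
      eval_toForm, eval_toForm,
      Submodule.mem_dualAnnihilator]
    constructor
    · exact fun h => ⟨h v (Submodule.subset_span (by simp)), h w (Submodule.subset_span (by simp))⟩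
    · rintro ⟨h1, h2⟩ u hu
      have : Submodule.span K {v, w} ≤ LinearMap.ker φ := by
        rw [Submodule.span_le]
        rintro x (rfl | rfl)
        exacts [h1, h2]
      exact this hu

theorem Line.finrank_dualCoannihilator (L : Line n K) :
    Module.finrank K (L.forms.comap (toForm n K)).dualCoannihilator = 2 := by
  have hmap : (L.forms.comap (toForm n K)).map (toForm n K) = L.forms := by
    rw [Submodule.map_comap_eq]
    exact inf_eq_right.mpr fun f hf => exists_toForm_eq (L.forms_le hf)
  have hfr : Module.finrank K (L.forms.comap (toForm n K)) = Module.finrank K L.forms := by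
    rw [(Submodule.equivMapOfInjective _ toForm_injective _).finrank_eq, hmap]
  have h := Subspace.finrank_add_finrank_dualCoannihilator_eq (L.forms.comap (toForm n K))
  have hL := L.finrank_forms
  rw [Module.finrank_fin_fun, hfr] at h
  omega

theorem Line.mem_dualCoannihilator_iff (L : Line n K) {v : Fin (n + 1) → K} :
    v ∈ (L.forms.comap (toForm n K)).dualCoannihilator ↔ ∀ f ∈ L.forms, eval v f = 0 := by
  rw [Submodule.mem_dualCoannihilator]
  constructor
  · intro h f hf
    obtain ⟨φ, rfl⟩ := exists_toForm_eq (L.forms_le hf)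
    rw [eval_toForm]
    exact h φ hf
  · intro h φ hφ
    rw [← eval_toForm]
    exact h _ hφ

theorem Line.exists_second_point (L : Line n K) {v : Fin (n + 1) → K} (hv : v ≠ 0) :
    ∃ w, w ∉ Submodule.span K {v} ∧ ∀ f ∈ L.forms, eval w f = 0 := by
  by_contra! hc
  have hle : (L.forms.comap (toForm n K)).dualCoannihilator ≤ Submodule.span K {v} := by
    intro w hw
    by_contra hwv
    obtain ⟨f, hf, hfw⟩ := hc w hwv
    exact hfw (L.mem_dualCoannihilator_iff.mp hw f hf)
  have := Submodule.finrank_mono hle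
  rw [L.finrank_dualCoannihilator, finrank_span_singleton hv] at this
  omega

/-- By dimension, `v` and `w` span the common zeros of `L.forms`; biduality then recovers `L.forms`
as the annihilator of that span. -/
theorem Line.mem_forms_iff (L : Line n K) {v w : Fin (n + 1) → K} (hv : v ≠ 0)
    (hw : w ∉ Submodule.span K {v}) (hvL : ∀ f ∈ L.forms, eval v f = 0)
    (hwL : ∀ f ∈ L.forms, eval w f = 0) {f : MvPolynomial (Fin (n + 1)) K}
    (hf : f ∈ grading n K 1) : f ∈ L.forms ↔ eval v f = 0 ∧ eval w f = 0 := by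
  refine ⟨fun h => ⟨hvL f h, hwL f h⟩, ?_⟩
  obtain ⟨φ, rfl⟩ := exists_toForm_eq hf
  rw [eval_toForm, eval_toForm]
  rintro ⟨h1, h2⟩
  have hspan : Submodule.span K {v, w} = (L.forms.comap (toForm n K)).dualCoannihilator := by
    apply Submodule.eq_of_le_of_finrank_eq
    · rw [Submodule.span_le]
      rintro x (rfl | rfl)
      exacts [L.mem_dualCoannihilator_iff.mpr hvL, L.mem_dualCoannihilator_iff.mpr hwL]
    · rw [finrank_span_pair hv hw, L.finrank_dualCoannihilator]
  change φ ∈ L.forms.comap (toForm n K)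
  rw [← Subspace.dualCoannihilator_dualAnnihilator_eq (W := L.forms.comap (toForm n K)), ← hspan,
    Submodule.mem_dualAnnihilator]
  intro u hu
  have : Submodule.span K {v, w} ≤ LinearMap.ker φ := by
    rw [Submodule.span_le]
    rintro x (rfl | rfl)
    exacts [h1, h2]
  exact this hu

theorem exists_form_eval {v w : Fin (n + 1) → K} (hw : w ∉ Submodule.span K {v}) :
    ∃ t ∈ grading n K 1, eval v t = 0 ∧ eval w t = 1 := by
  obtain ⟨φ, hφw, hφ⟩ := Submodule.exists_le_ker_of_notMem hw
  have hφv : φ v = 0 := hφ (Submodule.mem_span_singleton_self v)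
  refine ⟨toForm n K ((φ w)⁻¹ • φ), toForm_mem_grading _, ?_, ?_⟩
  · simp [eval_toForm, hφv]
  · simp [eval_toForm, hφw]

theorem exists_coordinate_forms {v w : Fin (n + 1) → K} (hv : v ≠ 0)
    (hw : w ∉ Submodule.span K {v}) :
    ∃ y ∈ grading n K 1, ∃ t ∈ grading n K 1,
      eval v y = 1 ∧ eval w y = 0 ∧ eval v t = 0 ∧ eval w t = 1 := by
  obtain ⟨t, ht, hvt, hwt⟩ := exists_form_eval hw
  obtain ⟨y, hy, hvy⟩ := exists_linear_eval_ne_zero v hv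
  refine ⟨(eval v y)⁻¹ • (y - eval w y • t), Submodule.smul_mem _ _
    (sub_mem hy (Submodule.smul_mem _ _ ht)), t, ht, ?_, ?_, hvt, hwt⟩
  · simp [smul_eval, hvt, hvy]
  · simp [smul_eval, hwt]

theorem Line.mem_carrier_iff (L : Line n K) {v : Fin (n + 1) → K} {hv : v ≠ 0} :
    point v hv ∈ L.carrier ↔ ∀ f ∈ L.forms, eval v f = 0 := by
  change L.ideal ≤ (point v hv).asHomogeneousIdeal ↔ _
  constructor
  · exact fun h f hf => eval_eq_zero_of_mem_point (h (Ideal.subset_span hf))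
  · intro h
    exact Ideal.span_le.mpr fun f hf => (mem_point_iff (L.forms_le hf)).mpr (h f hf)

end Lines

/-! ### Rewriting binary monomials -/

section BinaryForms

variable {K B : Type*} [Field K] [CommRing B] [Algebra K B]

variable (K) in
/-- The span of the monomials `t ^ (d - j) * y ^ j` with `j < k`. -/
def binarySpan (t y : B) (d k : ℕ) : Submodule K B :=
  Submodule.span K {z | ∃ j, j < k ∧ j ≤ d ∧ z = t ^ (d - j) * y ^ j}

theorem mem_binarySpan {t y : B} {i j d k : ℕ} (hj : j < k) (hd : i + j = d) :
    t ^ i * y ^ j ∈ binarySpan K t y d k :=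
  Submodule.subset_span ⟨j, hj, by omega, by rw [show i = d - j by omega]⟩

theorem mul_mem_binarySpan {t y z : B} {d k : ℕ} (hz : z ∈ binarySpan K t y d k) (α β : K) :
    (α • t + β • y) * z ∈ binarySpan K t y (d + 1) (k + 1) := by
  rw [add_mul, smul_mul_assoc, smul_mul_assoc]
  refine add_mem (Submodule.smul_mem _ _ ?_) (Submodule.smul_mem _ _ ?_)
  all_goals
    induction hz using Submodule.span_induction with
    | zero => simp
    | add a b _ _ ha hb =>
      rw [mul_add]
      exact add_mem ha hb
    | smul c a _ ha =>
      rw [mul_smul_comm]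
      exact Submodule.smul_mem _ _ ha
    | mem a ha =>
      obtain ⟨j, hj, hd, rfl⟩ := ha
      first
      | rw [← mul_assoc, ← pow_succ']
        exact mem_binarySpan (by omega) (by omega)
      | rw [mul_left_comm, ← pow_succ']
        exact mem_binarySpan (by omega) (by omega)

theorem binarySpan_eq_span_finset (t y : B) (d k : ℕ) :
    ∃ s : Finset B, s.card ≤ k ∧ binarySpan K t y d k = Submodule.span K (s : Set B) := by
  classical
  refine ⟨((Finset.range k).filter (· ≤ d)).image fun j => t ^ (d - j) * y ^ j, ?_, ?_⟩
  · exact Finset.card_image_le.trans ((Finset.card_filter_le _ _).trans (Finset.card_range k).le)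
  · rw [binarySpan]
    congr 1
    ext z
    simp only [Set.mem_ofPred_eq, Finset.coe_image, Set.mem_image, Finset.coe_filter,
      Finset.mem_range]
    exact ⟨fun ⟨j, h1, h2, h3⟩ => ⟨j, ⟨h1, h2⟩, h3.symm⟩, fun ⟨j, ⟨h1, h2⟩, h3⟩ => ⟨j, h1, h2, h3.symm⟩⟩

theorem finrank_le_of_le_binarySpan {t y : B} {d k : ℕ} {W : Submodule K B}
    (h : W ≤ binarySpan K t y d k) : Module.finrank K W ≤ k := by
  obtain ⟨s, hs, e⟩ := binarySpan_eq_span_finset (K := K) t y d k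
  rw [e] at h
  exact (Submodule.finrank_mono h).trans ((finrank_span_finset_le_card s).trans hs)

/-- The hypothesis rewrites `y ^ k` through lower powers whenever a factor `t ^ e` is available.
Each rewriting lowers the exponent of `y` and raises that of `t`, so the condition `j + e ≤ d`
persists and the process ends below `k`. -/
theorem pow_mul_pow_mem_binarySpan {t y : B} {e k : ℕ}
    (h : t ^ e * y ^ k ∈ binarySpan K t y (e + k) k) (j d : ℕ) (hd : j + e ≤ d) :
    t ^ (d - j) * y ^ j ∈ binarySpan K t y d k := by
  induction j using Nat.strong_induction_on with
  | _ j ih =>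
    by_cases hj : j < k
    · exact mem_binarySpan hj (by omega)
    · have e1 : t ^ (d - j) * y ^ j = t ^ (d - j - e) * y ^ (j - k) * (t ^ e * y ^ k) := by
        rw [mul_mul_mul_comm, ← pow_add, ← pow_add]
        congr 2 <;> omega
      rw [e1]
      have key : ∀ z ∈ binarySpan K t y (e + k) k,
          t ^ (d - j - e) * y ^ (j - k) * z ∈ binarySpan K t y d k := by
        intro z hz
        induction hz using Submodule.span_induction with
        | zero => simp
        | add a b _ _ ha hb =>
          rw [mul_add]
          exact add_mem ha hb
        | smul c a _ ha =>
          rw [mul_smul_comm]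
          exact Submodule.smul_mem _ _ ha
        | mem a ha =>
          obtain ⟨i, hi, hie, rfl⟩ := ha
          have := ih (j - k + i) (by omega) (by omega)
          rw [mul_mul_mul_comm, ← pow_add, ← pow_add]
          rwa [show d - j - e + (e + k - i) = d - (j - k + i) by omega]
      exact key _ h

end BinaryForms

/-! ### Restriction to the line through `v` and `w` -/

section Restriction

variable {n : ℕ} {K : Type u} [Field K] {B : Type*} [CommRing B] [Algebra K B]
  {v w : Fin (n + 1) → K} {hv : v ≠ 0}
  (q : MvPolynomial (Fin (n + 1)) K →ₐ[K] B)
  (hq : ∀ f ∈ grading n K 1, eval v f = 0 → eval w f = 0 → q f = 0)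
  {y t : MvPolynomial (Fin (n + 1)) K} (hy : y ∈ grading n K 1) (ht : t ∈ grading n K 1)
  (hvy : eval v y = 1) (hwy : eval w y = 0) (hvt : eval v t = 0) (hwt : eval w t = 1)

include hq hy ht hvy hwy hvt hwt

theorem restrict_linear {f : MvPolynomial (Fin (n + 1)) K} (hf : f ∈ grading n K 1) :
    q f = eval w f • q t + eval v f • q y := by
  have h := hq (f - (eval w f • t + eval v f • y))
    (sub_mem hf (add_mem (Submodule.smul_mem _ _ ht) (Submodule.smul_mem _ _ hy)))
    (by simp [smul_eval, hvy, hvt]) (by simp [smul_eval, hwy, hwt])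
  rw [map_sub, sub_eq_zero] at h
  rw [h, map_add, map_smul, map_smul]

theorem restrict_mem_binarySpan {d : ℕ} {f : MvPolynomial (Fin (n + 1)) K}
    (hf : f ∈ grading n K d) : q f ∈ binarySpan K (q t) (q y) d (d + 1) := by
  rw [grading, ← homogeneousSubmodule_one_pow] at hf
  induction hf using Submodule.pow_induction_on_left' with
  | algebraMap r =>
    rw [AlgHom.commutes, Algebra.algebraMap_eq_smul_one]
    refine Submodule.smul_mem _ _ ?_
    simpa using mem_binarySpan (K := K) (t := q t) (y := q y) (i := 0) (j := 0) (d := 0)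
      Nat.zero_lt_one rfl
  | add f g d _ _ hf hg =>
    rw [map_add]
    exact add_mem hf hg
  | mem_mul l hl d f _ ih =>
    rw [map_mul, restrict_linear q hq hy ht hvy hwy hvt hwt hl]
    exact mul_mem_binarySpan ih _ _

/-- The map `q` factors through the parametrization `w t + v y` of the line; elements of `S` ignore
the summand along `v`, and homogeneity extracts `t ^ d`. -/
theorem restrict_subalg {d : ℕ} {f : MvPolynomial (Fin (n + 1)) K}
    (hf : f ∈ grading n K d) (hfS : f ∈ subalg (point v hv).asHomogeneousIdeal) :
    q f = eval w f • q t ^ d := by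
  have h1 : q f = aeval (fun i => q t * algebraMap K B (w i) + q y * algebraMap K B (v i)) f := by
    have : q = aeval (fun i => q t * algebraMap K B (w i) + q y * algebraMap K B (v i)) := by
      ext i
      rw [aeval_X, restrict_linear q hq hy ht hvy hwy hvt hwt (X_mem_grading i), eval_X, eval_X,
        Algebra.smul_def, Algebra.smul_def, mul_comm, mul_comm (q y)]
    exact DFunLike.congr_fun this f
  rw [h1, aeval_add_mul_of_mem_subalg hfS, aeval_mul_of_mem_grading hf, Algebra.smul_def, mul_comm]
  congr 1
  exact (aeval_algebraMap_apply B w f).trans (by rw [aeval_eq_eval])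

theorem restrict_degLT {k : ℕ} {g : MvPolynomial (Fin (n + 1)) K}
    (hg : g ∈ degLT (point v hv).asHomogeneousIdeal y k) (d : ℕ) :
    q (DirectSum.decompose (grading n K) g d : MvPolynomial (Fin (n + 1)) K) ∈
      binarySpan K (q t) (q y) d k := by
  classical
  -- Taking the degree `d` component is not `S`-linear, so the induction runs over the products `s •
  -- y ^ i` and not over scalar multiplication.
  refine Submodule.closure_induction (p := fun g _ =>
    q (DirectSum.decompose (grading n K) g d : MvPolynomial (Fin (n + 1)) K) ∈
      binarySpan K (q t) (q y) d k) ?_ ?_ ?_ hg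
  · simp
  · intro x z _ _ hx hz
    rw [DirectSum.decompose_add, DirectSum.add_apply, AddMemClass.coe_add, map_add]
    exact add_mem hx hz
  · rintro s _ ⟨i, hi, rfl⟩
    rw [Subalgebra.smul_def, smul_eq_mul,
      DirectSum.coe_decompose_mul_of_right_mem _ _ (pow_mem_grading _ hy i)]
    split_ifs with hid
    · rw [map_mul, map_pow, restrict_subalg q hq hy ht hvy hwy hvt hwt
        (DirectSum.decompose (grading n K) (s : MvPolynomial (Fin (n + 1)) K) (d - i)).2
        (proj_mem_subalg _ s.2 _), smul_mul_assoc]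
      exact Submodule.smul_mem _ _ (mem_binarySpan hi (by omega))
    · simp

theorem restrict_relation {a : HomogeneousIdeal (grading n K)} (hqa : ∀ f ∈ a, q f = 0)
    {k e : ℕ} {f : subalg (point v hv).asHomogeneousIdeal}
    (hf : f ∈ partialElimNat (point v hv).asHomogeneousIdeal a k)
    (hfe : (f : MvPolynomial (Fin (n + 1)) K) ∈ grading n K e)
    (hfw : eval w (f : MvPolynomial (Fin (n + 1)) K) ≠ 0) :
    q t ^ e * q y ^ k ∈ binarySpan K (q t) (q y) (e + k) k := by
  obtain ⟨g, hg, hga⟩ := hf y hy (fun h => by simp [(mem_point_iff hy).mp h] at hvy)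
  have h1 := a.isHomogeneous (k + e) hga
  rw [DirectSum.decompose_add, DirectSum.add_apply, AddMemClass.coe_add,
    DirectSum.coe_decompose_mul_add_of_left_mem _ (pow_mem_grading _ hy k),
    DirectSum.decompose_of_mem_same _ hfe] at h1
  have h2 := hqa _ h1
  have h3 := restrict_degLT q hq hy ht hvy hwy hvt hwt hg (k + e)
  rw [map_add, map_mul, map_pow, restrict_subalg q hq hy ht hvy hwy hvt hwt hfe f.2,
    mul_smul_comm, add_eq_zero_iff_eq_neg] at h2
  rw [← neg_mem_iff, ← h2] at h3
  rw [add_comm e k, mul_comm]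
  exact (Submodule.smul_mem_iff _ hfw).mp h3

end Restriction

/-! ### Elimination ideals bound the length on a line from above -/

section SecantLines

variable {n : ℕ} {K : Type u} [Field K] {v w : Fin (n + 1) → K} {hv : v ≠ 0}

theorem finrank_quotGrading_le_of_mem_partialElimNat {a : HomogeneousIdeal (grading n K)}
    (ha : ¬ a ≤ (point v hv).asHomogeneousIdeal) (hw : w ∉ Submodule.span K {v}) (L : Line n K)
    (hL : ∀ f ∈ grading n K 1, f ∈ L.forms ↔ eval v f = 0 ∧ eval w f = 0)
    {k e : ℕ} {f : subalg (point v hv).asHomogeneousIdeal}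
    (hf : f ∈ partialElimNat (point v hv).asHomogeneousIdeal a k)
    (hfe : (f : MvPolynomial (Fin (n + 1)) K) ∈ grading n K e)
    (hfw : eval w (f : MvPolynomial (Fin (n + 1)) K) ≠ 0) :
    ∀ᶠ d in Filter.atTop, Module.finrank K (quotGrading (grading n K) (a ⊔ L.ideal) d) ≤ k := by
  obtain ⟨y, hy, t, ht, hvy, hwy, hvt, hwt⟩ := exists_coordinate_forms hv hw
  obtain ⟨m, hm⟩ := exists_one_mem_partialElimNat ha
  set q := Ideal.Quotient.mkₐ K (a ⊔ L.ideal).toIdeal with hqdef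
  have hq : ∀ f ∈ grading n K 1, eval v f = 0 → eval w f = 0 → q f = 0 := by
    intro f hf h1 h2
    exact Ideal.Quotient.eq_zero_iff_mem.mpr ((le_sup_right : L.ideal ≤ a ⊔ L.ideal)
      (Ideal.subset_span ((hL f hf).mpr ⟨h1, h2⟩)))
  have hqa : ∀ f ∈ a, q f = 0 := fun f hf =>
    Ideal.Quotient.eq_zero_iff_mem.mpr ((le_sup_left : a ≤ a ⊔ L.ideal) hf)
  have hone : ((1 : subalg (point v hv).asHomogeneousIdeal) : MvPolynomial (Fin (n + 1)) K) ∈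
      grading n K 0 := SetLike.GradedOne.one_mem
  -- The relation from `1 ∈ S` has `e = 0`, so it reduces to exponents below `m` in every degree.
  -- The relation `r2` from `f` needs a factor `t ^ e`, present once `j < m` and `m + e ≤ d`.
  have r1 := restrict_relation q hq hy ht hvy hwy hvt hwt hqa hm hone (by simp)
  have r2 := restrict_relation q hq hy ht hvy hwy hvt hwt hqa hf hfe hfw
  filter_upwards [Filter.eventually_ge_atTop (m + e)] with d hd
  refine finrank_le_of_le_binarySpan (t := q t) (y := q y) (d := d) ?_
  rintro _ ⟨F, hF, rfl⟩
  have h1 : binarySpan K (q t) (q y) d (d + 1) ≤ binarySpan K (q t) (q y) d m := by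
    refine Submodule.span_le.mpr ?_
    rintro _ ⟨j, -, hj, rfl⟩
    exact pow_mul_pow_mem_binarySpan r1 j d hj
  have h2 : binarySpan K (q t) (q y) d m ≤ binarySpan K (q t) (q y) d k := by
    refine Submodule.span_le.mpr ?_
    rintro _ ⟨j, hjm, -, rfl⟩
    exact pow_mul_pow_mem_binarySpan r2 j d (by omega)
  exact h2 (h1 (restrict_mem_binarySpan q hq hy ht hvy hwy hvt hwt hF))

theorem eval_eq_zero_of_le_intersectionLength {a : HomogeneousIdeal (grading n K)}
    (ha : ¬ a ≤ (point v hv).asHomogeneousIdeal) (hw : w ∉ Submodule.span K {v}) (L : Line n K)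
    (hL : ∀ f ∈ grading n K 1, f ∈ L.forms ↔ eval v f = 0 ∧ eval w f = 0) {k : ℕ}
    (hk : ((k + 1 : ℕ) : ℕ∞) ≤ intersectionLength a L.ideal)
    {f : subalg (point v hv).asHomogeneousIdeal}
    (hf : f ∈ partialElimNat (point v hv).asHomogeneousIdeal a k) :
    eval w (f : MvPolynomial (Fin (n + 1)) K) = 0 := by
  classical
  -- The length bound needs a homogeneous `f`; the elimination ideal contains all its components.
  rw [← DirectSum.sum_support_decompose (grading n K) (f : MvPolynomial (Fin (n + 1)) K), map_sum]
  refine Finset.sum_eq_zero fun e _ => ?_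
  by_contra h0
  have h1 := proj_mem_partialElim _ a (Int.ofNat k) f hf e
  have h2 := finrank_quotGrading_le_of_mem_partialElimNat ha hw L hL h1
    (DirectSum.decompose (grading n K) (f : MvPolynomial (Fin (n + 1)) K) e).2 h0
  have h3 : intersectionLength a L.ideal ≤ k := by
    refine Filter.liminf_le_of_frequently_le' (Filter.Eventually.frequently ?_)
    filter_upwards [h2] with d hd
    exact_mod_cast hd
  have := hk.trans h3
  norm_cast at this
  omega

end SecantLines

/-! ### Nakayama's lemma and the lower bound for the length -/

section Nakayama

variable {n : ℕ} {K : Type u} [Field K] {v w : Fin (n + 1) → K} {hv : v ≠ 0}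

/-- Division by the relation, made monic: over a field its actual degree may be below `k`, which
only shrinks the span. -/
theorem pow_mem_span_pow_lt {B : Type*} [CommRing B] [Algebra K B] {y : B} {k : ℕ}
    {c : Fin (k + 1) → K} (hc : c ≠ 0) (h : ∑ j, c j • y ^ (j : ℕ) = 0) (l : ℕ) :
    y ^ l ∈ Submodule.span K {z | ∃ i < k, z = y ^ i} := by
  classical
  set P : Polynomial K := ∑ j : Fin (k + 1), Polynomial.monomial (j : ℕ) (c j) with hP
  have hcoeff : ∀ j : Fin (k + 1), P.coeff j = c j := by
    intro j
    simp [hP, Polynomial.finsetSum_coeff, Polynomial.coeff_monomial, Fin.val_inj]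
  have hP0 : P ≠ 0 := by
    intro h0
    exact hc (funext fun j => by rw [← hcoeff, h0, Polynomial.coeff_zero]; rfl)
  have hdeg : P.natDegree ≤ k := by
    refine Polynomial.natDegree_sum_le_of_forall_le _ _ fun j _ => ?_
    exact (Polynomial.natDegree_monomial_le _).trans (Nat.lt_succ_iff.mp j.2)
  have hroot : Polynomial.aeval y P = 0 := by
    rw [hP, map_sum, ← h]
    exact Finset.sum_congr rfl fun j _ => by rw [Polynomial.aeval_monomial, Algebra.smul_def]
  have hmon : (P * Polynomial.C P.leadingCoeff⁻¹).Monic :=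
    Polynomial.monic_mul_leadingCoeff_inv hP0
  have hspan := Submodule.span_range_natDegree_eq_adjoin hmon
    (x := y) (by rw [map_mul, hroot, zero_mul])
  have hy : y ^ l ∈ Subalgebra.toSubmodule (Algebra.adjoin K {y}) :=
    pow_mem (Algebra.self_mem_adjoin_singleton K y) l
  rw [← hspan] at hy
  refine Submodule.span_mono ?_ hy
  intro z hz
  simp only [Finset.coe_image, Finset.coe_range, Set.mem_image, Set.mem_Iio] at hz
  obtain ⟨i, hi, rfl⟩ := hz
  refine ⟨i, ?_, rfl⟩
  rw [Polynomial.natDegree_mul_leadingCoeff_inv _ hP0] at hi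
  omega

variable (v w hv) in
/-- The maximal ideal of `S` of all elements that vanish at `w`. -/
noncomputable def evalKer : Ideal (subalg (point v hv).asHomogeneousIdeal) :=
  RingHom.ker ((eval w).comp (subalg (point v hv).asHomogeneousIdeal).val.toRingHom)

theorem mem_evalKer {s : subalg (point v hv).asHomogeneousIdeal} :
    s ∈ evalKer v w hv ↔ eval w (s : MvPolynomial (Fin (n + 1)) K) = 0 := Iff.rfl

/-- The monic relation of degree `m` makes `R / a` a finite `S`-module generated by `1, …, y ^ (m -
1)`. -/
theorem degLT_sup_eq_top {a : HomogeneousIdeal (grading n K)}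
    {y : MvPolynomial (Fin (n + 1)) K} (hy : y ∈ grading n K 1) (hyv : eval v y ≠ 0) {m : ℕ}
    (hm : (1 : subalg (point v hv).asHomogeneousIdeal) ∈
      partialElimNat (point v hv).asHomogeneousIdeal a m) :
    a.toIdeal.restrictScalars (subalg (point v hv).asHomogeneousIdeal) ⊔
      degLT (point v hv).asHomogeneousIdeal y m = ⊤ := by
  set Q := a.toIdeal.restrictScalars (subalg (point v hv).asHomogeneousIdeal) ⊔
      degLT (point v hv).asHomogeneousIdeal y m with hQ
  obtain ⟨g, hg, hga⟩ := hm y hy (fun h => hyv ((mem_point_iff hy).mp h))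
  have hym : y ^ m ∈ Q := by
    have h1 : y ^ m * ((1 : subalg (point v hv).asHomogeneousIdeal) :
        MvPolynomial (Fin (n + 1)) K) + g ∈ Q := (le_sup_left : _ ≤ Q) hga
    have h2 : g ∈ Q := (le_sup_right : _ ≤ Q) hg
    simpa using sub_mem h1 h2
  have hsucc : degLT (point v hv).asHomogeneousIdeal y (m + 1) ≤ Q := by
    refine Submodule.span_le.mpr ?_
    rintro _ ⟨i, hi, rfl⟩
    rcases Nat.lt_succ_iff_lt_or_eq.mp hi with h | rfl
    · exact (le_sup_right : _ ≤ Q) (pow_mem_degLT _ y h)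
    · exact hym
  have hpow : ∀ l, y ^ l ∈ Q := by
    intro l
    induction l with
    | zero => exact hsucc (pow_mem_degLT _ y m.succ_pos)
    | succ l ih =>
      obtain ⟨α, hα, β, hβ, e⟩ := Submodule.mem_sup.mp ih
      rw [pow_succ', ← e, mul_add]
      exact add_mem ((le_sup_left : _ ≤ Q) (a.toIdeal.mul_mem_left y hα))
        (hsucc (self_mul_mem_degLT _ y hβ))
  rw [eq_top_iff]
  intro f _
  obtain ⟨l, hl⟩ := exists_mem_degLT (hv := hv) hy hyv f
  refine (Submodule.span_le.mpr ?_ : degLT _ y l ≤ Q) hl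
  rintro _ ⟨i, -, rfl⟩
  exact hpow i

/-- In the fibre of `R / a` over `w`, elements of `S` become their values at `w` and `t` becomes
`1`, so the relation is a nonzero polynomial equation for `y` of degree at most `k`. Hence `1, …, y
^ (k - 1)` span the fibre, and by Nakayama they span `R / a` after multiplication by some `r` with
`r(w) = 1`; apply this to `y ^ k`. -/
theorem exists_eval_ne_zero_of_linear_relation {a : HomogeneousIdeal (grading n K)}
    (ha : ¬ a ≤ (point v hv).asHomogeneousIdeal) {y t : MvPolynomial (Fin (n + 1)) K}
    (hy : y ∈ grading n K 1) (ht : t ∈ grading n K 1)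
    (hvy : eval v y = 1) (hvt : eval v t = 0) (hwt : eval w t = 1)
    {I : Ideal (MvPolynomial (Fin (n + 1)) K)}
    (hI : ∀ f ∈ I, f ∈ a.toIdeal ⊔ (evalKer v w hv).map (subalg (point v hv).asHomogeneousIdeal).val)
    {k d : ℕ} {c : Fin (k + 1) → K} (hc : c ≠ 0)
    (hrel : ∑ j, c j • (t ^ (d - j : ℕ) * y ^ (j : ℕ)) ∈ I) :
    ∃ f ∈ partialElimNat (point v hv).asHomogeneousIdeal a k,
      eval w (f : MvPolynomial (Fin (n + 1)) K) ≠ 0 := by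
  have hyv : eval v y ≠ 0 := by simp [hvy]
  set S := subalg (point v hv).asHomogeneousIdeal with hS
  set J := a.toIdeal ⊔ (evalKer v w hv).map S.val with hJ
  set q := Ideal.Quotient.mkₐ K J with hqdef
  have hqS : ∀ s : S, q (s : MvPolynomial (Fin (n + 1)) K) =
      algebraMap K _ (eval w (s : MvPolynomial (Fin (n + 1)) K)) := by
    intro s
    have h1 : s - algebraMap K S (eval w (s : MvPolynomial (Fin (n + 1)) K)) ∈
        evalKer v w hv := by
      rw [mem_evalKer]
      change eval w ((s : MvPolynomial (Fin (n + 1)) K) - C _) = 0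
      simp
    have h2 : q ((s : MvPolynomial (Fin (n + 1)) K) -
        C (eval w (s : MvPolynomial (Fin (n + 1)) K))) = 0 :=
      Ideal.Quotient.eq_zero_iff_mem.mpr
        ((le_sup_right : _ ≤ J) (Ideal.mem_map_of_mem S.val h1))
    rw [map_sub, sub_eq_zero] at h2
    rw [h2]
    exact q.commutes _
  have hqt : q t = 1 := by
    have := hqS ⟨t, mem_subalg_of_eval_eq_zero ht hvt⟩
    simpa [hwt] using this
  have hqrel : ∑ j, c j • q y ^ (j : ℕ) = 0 := by
    have h1 : q (∑ j, c j • (t ^ (d - j : ℕ) * y ^ (j : ℕ))) = 0 :=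
      Ideal.Quotient.eq_zero_iff_mem.mpr (hI _ hrel)
    simpa [hqt] using h1
  have hmem : ∀ f, ∃ g ∈ degLT (point v hv).asHomogeneousIdeal y k, f - g ∈ J := by
    have hlift : ∀ z ∈ Submodule.span K {z | ∃ i < k, z = q y ^ i},
        ∃ g ∈ degLT (point v hv).asHomogeneousIdeal y k, q g = z := by
      intro z hz
      induction hz using Submodule.span_induction with
      | mem z hz =>
        obtain ⟨i, hi, rfl⟩ := hz
        exact ⟨y ^ i, pow_mem_degLT _ y hi, map_pow q y i⟩
      | zero => exact ⟨0, zero_mem _, map_zero q⟩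
      | add a b _ _ ha hb =>
        obtain ⟨g, hg, rfl⟩ := ha
        obtain ⟨g', hg', rfl⟩ := hb
        exact ⟨g + g', add_mem hg hg', map_add q g g'⟩
      | smul c a _ ha =>
        obtain ⟨g, hg, rfl⟩ := ha
        refine ⟨c • g, ?_, map_smul q c g⟩
        rw [smul_eq_C_mul]
        exact mul_mem_degLT _ y (C_mem_subalg _ c) hg
    intro f
    obtain ⟨l, hl⟩ := exists_mem_degLT (hv := hv) hy hyv f
    have hf : q f ∈ Submodule.span K {z | ∃ i < k, z = q y ^ i} := by
      induction hl using Submodule.span_induction with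
      | mem z hz =>
        obtain ⟨i, -, rfl⟩ := hz
        rw [map_pow]
        exact pow_mem_span_pow_lt hc hqrel i
      | zero => simp
      | add a b _ _ ha hb =>
        rw [map_add]
        exact add_mem ha hb
      | smul s a _ ha =>
        rw [Subalgebra.smul_def, smul_eq_mul, map_mul, hqS, ← Algebra.smul_def]
        exact Submodule.smul_mem _ _ ha
    obtain ⟨g, hg, e⟩ := hlift _ hf
    refine ⟨g, hg, Ideal.Quotient.eq_zero_iff_mem.mp ?_⟩
    change q (f - g) = 0
    rw [map_sub, e, sub_self]
  obtain ⟨m, hm⟩ := exists_one_mem_partialElimNat ha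
  have htop := degLT_sup_eq_top hy hyv hm
  set N := a.toIdeal.restrictScalars S ⊔ degLT (point v hv).asHomogeneousIdeal y k with hN
  have hfg : (degLT (point v hv).asHomogeneousIdeal y m).FG := by
    refine Submodule.fg_span (Set.Finite.subset (Set.finite_range fun i : Fin m => y ^ (i : ℕ)) ?_)
    rintro _ ⟨i, hi, rfl⟩
    exact ⟨⟨i, hi⟩, rfl⟩
  -- The whole of `R` need not be finite over `S`, so Nakayama is applied to the finite module
  -- `degLT y m`, which together with `a` fills `R`.
  have hnak : (⊤ : Submodule S (MvPolynomial (Fin (n + 1)) K)) ≤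
      N ⊔ evalKer v w hv • degLT (point v hv).asHomogeneousIdeal y m := by
    intro f _
    obtain ⟨g, hg, hfg⟩ := hmem f
    obtain ⟨α, hα, β, hβ, e⟩ := Submodule.mem_sup.mp hfg
    have hβ' : β ∈ evalKer v w hv • (⊤ : Submodule S (MvPolynomial (Fin (n + 1)) K)) := by
      rw [Ideal.smul_top_eq_map]
      exact hβ
    rw [← htop, Submodule.smul_sup] at hβ'
    have hle : evalKer v w hv • a.toIdeal.restrictScalars S ⊔
        evalKer v w hv • degLT (point v hv).asHomogeneousIdeal y m ≤
        N ⊔ evalKer v w hv • degLT (point v hv).asHomogeneousIdeal y m :=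
      sup_le_sup_right (Submodule.smul_le_right.trans le_sup_left) _
    have hfeq : f = α + g + β := by
      rw [add_right_comm, e]
      ring
    rw [hfeq]
    refine add_mem ((le_sup_left : N ≤ _) (add_mem ((le_sup_left : _ ≤ N) hα)
      ((le_sup_right : _ ≤ N) hg))) (hle hβ')
  obtain ⟨r, hr, hrN⟩ := Submodule.exists_sub_one_mem_and_smul_le_of_fg_of_le_sup hfg le_top hnak
  have hry : (r : MvPolynomial (Fin (n + 1)) K) * y ^ k ∈ N :=
    hrN (Submodule.smul_mem_pointwise_smul (y ^ k) r ⊤ trivial)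
  refine ⟨r, mem_partialElimNat_of_exists hy hyv ?_, ?_⟩
  · obtain ⟨α, hα, β, hβ, e⟩ := Submodule.mem_sup.mp hry
    refine ⟨-β, neg_mem hβ, ?_⟩
    rw [mul_comm, ← e, add_neg_cancel_right]
    exact hα
  · rw [mem_evalKer] at hr
    have : eval w (r : MvPolynomial (Fin (n + 1)) K) = 1 := by
      simpa [sub_eq_zero] using hr
    rw [this]
    exact one_ne_zero

theorem le_intersectionLength {a : HomogeneousIdeal (grading n K)}
    (ha : ¬ a ≤ (point v hv).asHomogeneousIdeal) (hw : w ∉ Submodule.span K {v}) (L : Line n K)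
    (hL : ∀ f ∈ grading n K 1, f ∈ L.forms ↔ eval v f = 0 ∧ eval w f = 0) {k : ℕ}
    (h : ∀ f ∈ partialElimNat (point v hv).asHomogeneousIdeal a k,
      eval w (f : MvPolynomial (Fin (n + 1)) K) = 0) :
    ((k + 1 : ℕ) : ℕ∞) ≤ intersectionLength a L.ideal := by
  by_contra hlt
  rw [not_le] at hlt
  -- A small lower limit gives small dimensions in arbitrarily high degrees; `d ≥ k` ensures that
  -- all `k + 1` monomials `t ^ (d - j) y ^ j` have degree `d`.
  obtain ⟨d, hd, hdk⟩ :=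
    ((Filter.frequently_lt_of_liminf_lt (h := hlt)).and_eventually
      (Filter.eventually_ge_atTop k)).exists
  obtain ⟨y, hy, t, ht, hvy, hwy, hvt, hwt⟩ := exists_coordinate_forms hv hw
  have hfin : Module.Finite K (quotGrading (grading n K) (a ⊔ L.ideal) d) :=
    Module.Finite.iff_fg.mpr ((homogeneousSubmodule_fg _ _ d).map _)
  have hmono : ∀ j : Fin (k + 1), t ^ (d - j : ℕ) * y ^ (j : ℕ) ∈ grading n K d := by
    intro j
    have := SetLike.mul_mem_graded (pow_mem_grading _ ht (d - j)) (pow_mem_grading _ hy j)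
    rwa [Nat.sub_add_cancel ((Nat.lt_succ_iff.mp j.2).trans hdk)] at this
  set b : Fin (k + 1) → quotGrading (grading n K) (a ⊔ L.ideal) d := fun j =>
    ⟨_, mk_mem_quotGrading (grading n K) (a ⊔ L.ideal) (hmono j)⟩ with hb
  have hdep : ¬ LinearIndependent K b := by
    intro hli
    have h1 := hli.fintype_card_le_finrank
    rw [Fintype.card_fin] at h1
    exact absurd hd (not_lt.mpr (by exact_mod_cast h1))
  rw [Fintype.not_linearIndependent_iff] at hdep
  obtain ⟨c, hc, i, hi⟩ := hdep
  have hrel : ∑ j, c j • (t ^ (d - j : ℕ) * y ^ (j : ℕ)) ∈ (a ⊔ L.ideal).toIdeal := by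
    rw [← Ideal.Quotient.eq_zero_iff_mem]
    have := congrArg Subtype.val hc
    simp only [AddSubmonoidClass.coe_finsetSum, SetLike.val_smul, hb, ZeroMemClass.coe_zero] at this
    rw [← this]
    exact map_sum (Ideal.Quotient.mkₐ K (a ⊔ L.ideal).toIdeal) _ _
  -- The forms of `L` vanish at `v`, hence lie in `S`, and vanish at `w`, hence lie in the maximal
  -- ideal there.
  have hle : (a ⊔ L.ideal).toIdeal ≤ a.toIdeal ⊔
      (evalKer v w hv).map (subalg (point v hv).asHomogeneousIdeal).val := by
    rw [HomogeneousIdeal.toIdeal_sup]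
    refine sup_le_sup_left (Ideal.span_le.mpr fun l hl => ?_) _
    have hl1 := L.forms_le hl
    obtain ⟨h1, h2⟩ := (hL l hl1).mp hl
    exact Ideal.mem_map_of_mem (subalg (point v hv).asHomogeneousIdeal).val
      (x := ⟨l, mem_subalg_of_eval_eq_zero hl1 h1⟩) (mem_evalKer.mpr h2)
  obtain ⟨f, hf, hfw⟩ := exists_eval_ne_zero_of_linear_relation ha hy ht hvy hvt hwt
    (fun f hf => hle hf) (fun h0 => hi (by rw [h0]; rfl)) hrel
  exact hfw (h f hf)

end Nakayama

/-! ### Secant cones and secant loci as schemes -/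

section SecantCones

variable {n : ℕ} {K : Type u} [Field K] {v w : Fin (n + 1) → K} {hv : v ≠ 0} {hw : w ≠ 0}

theorem radical_le_asHomogeneousIdeal_iff (J : HomogeneousIdeal (grading n K))
    (x : ProjSpace n K) : J.radical ≤ x.asHomogeneousIdeal ↔ J ≤ x.asHomogeneousIdeal :=
  x.isPrime.radical_le_iff

theorem partialElimExt_le_point_iff {a : HomogeneousIdeal (grading n K)} {k : ℤ} :
    (partialElimExt (point v hv).asHomogeneousIdeal a k).radical ≤
        (point w hw).asHomogeneousIdeal ↔
      ∀ f ∈ partialElim (point v hv).asHomogeneousIdeal a k,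
        eval w (f : MvPolynomial (Fin (n + 1)) K) = 0 := by
  rw [radical_le_asHomogeneousIdeal_iff, le_point_iff]
  constructor
  · exact fun h f hf => h _ (Ideal.mem_map_of_mem (subalg (point v hv).asHomogeneousIdeal).val hf)
  · intro h f hf
    have hle : (partialElim (point v hv).asHomogeneousIdeal a k).map
        (subalg (point v hv).asHomogeneousIdeal).val ≤ RingHom.ker (eval w) :=
      Ideal.map_le_iff_le_comap.mpr h
    exact hle hf

theorem point_eq_of_mem_span (h : w ∈ Submodule.span K {v}) : point w hw = point v hv := by
  obtain ⟨c, rfl⟩ := Submodule.mem_span_singleton.mp h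
  exact point_eq_point_of_smul hw hv c rfl

theorem partialElim_succ (p a : HomogeneousIdeal (grading n K)) (k : ℕ) :
    partialElim p a (((k + 1 : ℕ) : ℤ) - 1) = partialElimNat p a k := by
  rw [Nat.cast_succ, add_sub_cancel_right]
  rfl

theorem partialElim_zero (p a : HomogeneousIdeal (grading n K)) :
    partialElim p a (((0 : ℕ) : ℤ) - 1) = ⊥ := rfl

variable {Z : (ProjSpace n K).IdealSheafData}

theorem gc_projSpace : GaloisConnection (projQuotient (grading n K)) (idealOf (grading n K)) :=
  gc_projQuotient_idealOf (grading n K)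
    (s := (X : Fin (n + 1) → MvPolynomial (Fin (n + 1)) K)) (fun i => X_mem_grading i)
    irrelevant_le_span_X

theorem projQuotient_idealOf_projSpace (Z : (ProjSpace n K).IdealSheafData) :
    projQuotient (grading n K) (idealOf (grading n K) Z) = Z :=
  projQuotient_idealOf (grading n K)
    (s := (X : Fin (n + 1) → MvPolynomial (Fin (n + 1)) K)) (fun i => X_mem_grading i)
    irrelevant_le_span_X Z

theorem projQuotient_radical_projSpace (J : HomogeneousIdeal (grading n K)) :
    projQuotient (grading n K) J.radical =
      Scheme.IdealSheafData.vanishingIdeal (projQuotient (grading n K) J.radical).support :=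
  projQuotient_radical (grading n K)
    (s := (X : Fin (n + 1) → MvPolynomial (Fin (n + 1)) K)) (fun i => X_mem_grading i)
    irrelevant_le_span_X J

theorem not_idealOf_le (hZ : point v hv ∉ Z.support) :
    ¬ idealOf (grading n K) Z ≤ (point v hv).asHomogeneousIdeal := by
  rwa [← mem_support_projQuotient, projQuotient_idealOf_projSpace]

/-- Away from `p` this is the equivalence of length and vanishing on the line joining the two
points. At `p` itself, properness of the graded ideal forces its elements to vanish. For `k = 0` the
ideal is zero and every line qualifies. -/
theorem point_mem_secantConePoints_iff (hZ : point v hv ∉ Z.support) {k : ℕ}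
    (hk : partialElim (point v hv).asHomogeneousIdeal (idealOf (grading n K) Z) ((k : ℤ) - 1) ≠ ⊤) :
    point w hw ∈ secantConePoints k Z (point v hv) ↔
      (partialElimExt (point v hv).asHomogeneousIdeal (idealOf (grading n K) Z)
        ((k : ℤ) - 1)).radical ≤ (point w hw).asHomogeneousIdeal := by
  have ha := not_idealOf_le hZ
  have hvk : (partialElimExt (point v hv).asHomogeneousIdeal (idealOf (grading n K) Z)
      ((k : ℤ) - 1)).radical ≤ (point v hv).asHomogeneousIdeal :=
    partialElimExt_le_point_iff.mpr fun f hf => eval_eq_zero_of_mem_partialElim hk hf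
  by_cases hwv : w ∈ Submodule.span K {v}
  · rw [point_eq_of_mem_span (hv := hv) hwv]
    exact ⟨fun _ => hvk, fun _ => ⟨isClosed_point v hv, Or.inl rfl⟩⟩
  rw [partialElimExt_le_point_iff]
  constructor
  · rintro ⟨-, h | ⟨L, hLk, hvL, hwL⟩⟩
    · intro f hf
      refine eval_eq_zero_of_mem_point (hv := hw) ?_
      rw [h]
      exact hvk (Ideal.le_radical
        (Ideal.mem_map_of_mem (subalg (point v hv).asHomogeneousIdeal).val hf))
    · rw [L.mem_carrier_iff] at hvL hwL
      cases k with
      | zero =>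
        intro f hf
        rw [partialElim_zero, Ideal.mem_bot] at hf
        simp [hf]
      | succ k =>
        intro f hf
        rw [partialElim_succ] at hf
        exact eval_eq_zero_of_le_intersectionLength ha hwv L
          (fun f hf => L.mem_forms_iff hv hwv hvL hwL hf) hLk hf
  · intro h
    obtain ⟨L, hL⟩ := exists_line hv hwv
    refine ⟨isClosed_point w hw, Or.inr ⟨L, ?_, ?_, ?_⟩⟩
    · cases k with
      | zero => simp [IsSecantLine]
      | succ k =>
        rw [partialElim_succ] at h
        exact le_intersectionLength ha hwv L hL h
    · exact L.mem_carrier_iff.mpr fun f hf => ((hL f (L.forms_le hf)).mp hf).1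
    · exact L.mem_carrier_iff.mpr fun f hf => ((hL f (L.forms_le hf)).mp hf).2

/-- A `k`-secant line through `p` has a second point, at which the element `1` of the ideal would
have to vanish; for `k = 0` the zero ideal is not the unit ideal. -/
theorem secantConePoints_eq_singleton (hZ : point v hv ∉ Z.support) {k : ℕ}
    (hk : partialElim (point v hv).asHomogeneousIdeal (idealOf (grading n K) Z) ((k : ℤ) - 1) = ⊤) :
    secantConePoints k Z (point v hv) = {point v hv} := by
  apply subset_antisymm
  · rintro x ⟨-, h | ⟨L, hLk, hvL, -⟩⟩
    · exact h
    · exfalso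
      have h1 : (1 : subalg (point v hv).asHomogeneousIdeal) ∈
          partialElim (point v hv).asHomogeneousIdeal (idealOf (grading n K) Z) ((k : ℤ) - 1) := by
        rw [hk]
        trivial
      cases k with
      | zero =>
        rw [partialElim_zero, Ideal.mem_bot] at h1
        exact one_ne_zero h1
      | succ k =>
        rw [partialElim_succ] at h1
        rw [L.mem_carrier_iff] at hvL
        obtain ⟨u, huv, huL⟩ := L.exists_second_point hv
        have := eval_eq_zero_of_le_intersectionLength (not_idealOf_le hZ) huv L
          (fun f hf => L.mem_forms_iff hv huv hvL huL hf) hLk h1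
        simp at this
  · rintro x rfl
    exact ⟨isClosed_point v hv, Or.inl rfl⟩

theorem closure_secantConePoints [IsAlgClosed K] (hZ : point v hv ∉ Z.support) {k : ℕ}
    (hk : partialElim (point v hv).asHomogeneousIdeal (idealOf (grading n K) Z) ((k : ℤ) - 1) ≠ ⊤) :
    closure (secantConePoints k Z (point v hv)) =
      {x : ProjSpace n K | (partialElimExt (point v hv).asHomogeneousIdeal
        (idealOf (grading n K) Z) ((k : ℤ) - 1)).radical ≤ x.asHomogeneousIdeal} := by
  refine closure_eq_of_forall_point_mem_iff _ _ (fun x hx => ?_) fun w hw h =>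
    (point_mem_secantConePoints_iff hZ hk).mpr h
  obtain ⟨w, hw, rfl⟩ := exists_eq_point hx.1
  exact (point_mem_secantConePoints_iff hZ hk).mp hx

theorem secantCone_eq_projQuotient [IsAlgClosed K] (hZ : point v hv ∉ Z.support) {k : ℕ}
    (hk : partialElim (point v hv).asHomogeneousIdeal (idealOf (grading n K) Z) ((k : ℤ) - 1) ≠ ⊤) :
    secantCone k Z (point v hv) = projQuotient (grading n K)
      (partialElimExt (point v hv).asHomogeneousIdeal (idealOf (grading n K) Z)
        ((k : ℤ) - 1)).radical := by
  rw [projQuotient_radical_projSpace, secantCone]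
  congr 1
  apply TopologicalSpace.Closeds.ext
  rw [TopologicalSpace.Closeds.coe_closure, closure_secantConePoints hZ hk]
  ext x
  exact (mem_support_projQuotient _ _ x).symm

theorem secantCone_eq_vanishingIdeal_singleton (hZ : point v hv ∉ Z.support) {k : ℕ}
    (hk : partialElim (point v hv).asHomogeneousIdeal (idealOf (grading n K) Z) ((k : ℤ) - 1) = ⊤) :
    secantCone k Z (point v hv) =
      Scheme.IdealSheafData.vanishingIdeal ⟨{point v hv}, isClosed_point v hv⟩ := by
  rw [secantCone, secantConePoints_eq_singleton hZ hk]
  congr 1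
  apply TopologicalSpace.Closeds.ext
  rw [TopologicalSpace.Closeds.coe_closure, (isClosed_point v hv).closure_eq]
  rfl

theorem projQuotient_eq_top {J : HomogeneousIdeal (grading n K)} (h : J = ⊤) :
    projQuotient (grading n K) J = ⊤ := by
  rw [← Scheme.IdealSheafData.support_eq_bot_iff, eq_bot_iff]
  intro x hx
  have hx' := (mem_support_projQuotient _ J x).mp hx
  rw [h, top_le_iff] at hx'
  exact x.isPrime.ne_top (by rw [hx']; rfl)

theorem sup_vanishingIdeal_singleton_eq_top {X : Scheme.{u}} (I : X.IdealSheafData) {x : X}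
    (hx : IsClosed {x}) (h : x ∉ I.support) :
    I ⊔ Scheme.IdealSheafData.vanishingIdeal ⟨{x}, hx⟩ = ⊤ := by
  rw [← Scheme.IdealSheafData.support_eq_bot_iff, Scheme.IdealSheafData.support_sup, eq_bot_iff]
  rintro y ⟨hy, hyx⟩
  have hyx' : y ∈ ((Scheme.IdealSheafData.vanishingIdeal ⟨{x}, hx⟩).support : Set X) := hyx
  rw [Scheme.IdealSheafData.coe_support_vanishingIdeal] at hyx'
  exact h (Set.mem_singleton_iff.mp hyx' ▸ hy)

/-- A lower adjoint preserves suprema, and `Z` is recovered from its homogeneous ideal. -/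
theorem projQuotient_idealOf_sup (Z : (ProjSpace n K).IdealSheafData)
    (J : HomogeneousIdeal (grading n K)) :
    projQuotient (grading n K) (idealOf (grading n K) Z ⊔ J) =
      Z ⊔ projQuotient (grading n K) J := by
  apply le_antisymm
  · rw [gc_projSpace.le_iff_le]
    exact sup_le (gc_projSpace.monotone_u le_sup_left) (gc_projSpace.le_iff_le.mp le_sup_right)
  · refine sup_le ?_ (gc_projSpace.monotone_l le_sup_right)
    calc Z = projQuotient (grading n K) (idealOf (grading n K) Z) :=
          (projQuotient_idealOf_projSpace Z).symm
      _ ≤ _ := gc_projSpace.monotone_l le_sup_left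

theorem secantLocus_eq_projQuotient [IsAlgClosed K] (hZ : point v hv ∉ Z.support) (k : ℕ) :
    secantLocus k Z (point v hv) = projQuotient (grading n K)
      (idealOf (grading n K) Z ⊔ (partialElimExt (point v hv).asHomogeneousIdeal
        (idealOf (grading n K) Z) ((k : ℤ) - 1)).radical) := by
  rw [secantLocus]
  by_cases hk : partialElim (point v hv).asHomogeneousIdeal (idealOf (grading n K) Z)
      ((k : ℤ) - 1) = ⊤
  -- Both sides are empty: the cone is the point `p`, which is not on `Z`, and the ideal on the
  -- right contains `1`.
  · rw [secantCone_eq_vanishingIdeal_singleton hZ hk,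
      sup_vanishingIdeal_singleton_eq_top Z _ hZ, projQuotient_eq_top]
    have h1 : (1 : MvPolynomial (Fin (n + 1)) K) ∈
        partialElimExt (point v hv).asHomogeneousIdeal (idealOf (grading n K) Z)
          ((k : ℤ) - 1) :=
      Ideal.mem_map_of_mem (subalg (point v hv).asHomogeneousIdeal).val
        (x := 1) (by rw [hk]; trivial)
    rw [HomogeneousIdeal.eq_top_iff, Ideal.eq_top_iff_one]
    exact (le_sup_right : _ ≤ idealOf (grading n K) Z ⊔ _) (Ideal.le_radical h1)
  · rw [secantCone_eq_projQuotient hZ hk]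
    exact (projQuotient_idealOf_sup Z _).symm

end SecantCones

end SecantCone

theorem mainTheorem1 {K : Type u} [Field K] [IsAlgClosed K] (n : ℕ)
    (Z : (ProjSpace n K).IdealSheafData) (p : ProjSpace n K)
    (hp : IsClosed {p}) (hpZ : p ∉ Z.support) (k : ℕ) :
    -- the secant cone is a closed subset of the space of closed points
    (∀ x ∈ closure (secantConePoints k Z p), IsClosed {x} →
      x ∈ secantConePoints k Z p) ∧
    (partialElim p.asHomogeneousIdeal
        (idealOf (grading n K) Z) ((k : ℤ) - 1) ≠ ⊤ →
      secantCone k Z p =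
        projQuotient (grading n K)
          (partialElimExt p.asHomogeneousIdeal
            (idealOf (grading n K) Z) ((k : ℤ) - 1)).radical) ∧
    (partialElim p.asHomogeneousIdeal
        (idealOf (grading n K) Z) ((k : ℤ) - 1) = ⊤ →
      secantCone k Z p =
        Scheme.IdealSheafData.vanishingIdeal ⟨{p}, hp⟩) ∧
    secantLocus k Z p =
      projQuotient (grading n K)
        (idealOf (grading n K) Z ⊔
          (partialElimExt p.asHomogeneousIdeal
            (idealOf (grading n K) Z) ((k : ℤ) - 1)).radical) := by
  obtain ⟨v, hv, rfl⟩ := exists_eq_point hp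
  refine ⟨fun x hx hxc => ?_, secantCone_eq_projQuotient hpZ,
    secantCone_eq_vanishingIdeal_singleton hpZ, secantLocus_eq_projQuotient hpZ k⟩
  by_cases hk : partialElim (point v hv).asHomogeneousIdeal (idealOf (grading n K) Z)
      ((k : ℤ) - 1) = ⊤
  · rw [secantConePoints_eq_singleton hpZ hk] at hx ⊢
    rwa [hp.closure_eq] at hx
  · obtain ⟨w, hw, rfl⟩ := exists_eq_point hxc
    rw [closure_secantConePoints hpZ hk] at hx
    exact (point_mem_secantConePoints_iff hpZ hk).mpr hx
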